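/- **Setting.** There are $n\ge 1$ processors $p_0,\dots,p_{n-1}$; $t$ is the largest integer less than $n/3$, and $f\le t$ processors are Byzantine (behave arbitrarily), the others are correct. Signatures and threshold signatures are unforgeable. Messages are not lost, arrive strictly after they are sent, and only finitely many are sent in bounded time; a message sent at time $s$ between correct processors arrives by time $\max\{GST,s\}+\delta$, where $0<\delta\le\Delta$; $\Delta$ is known, while $GST\ge 0$, $\delta$ and $f$ are not. Fix $k\ge 3$ and a real $x\ge 2$, and let $\Gamma=x\Delta$. The leader of view $v$ is $\mathtt{lead}(v)=p_{\lfloor v/k\rfloor \bmod n}$; $v$ is *initial* if $k\mid v$. *Partial initial clock synchronisation:* a correct processor begins the execution when its clock reads $0$; at time $0$ the clocks of correct processors are $\le 0$, and for each correct $p$ at least $t+1$ correct processors ($p$ included) have clocks at most $\Gamma$ behind that of $p$. Clocks of correct processors all run at speed one, except for the forwarding described next. **The protocol Fever.** The clock-time of view $v$ is $c_v=\Gamma v$. A processor enters an initial view $v$ when its clock equals $c_v$, and then sends a signed $\mathtt{view}\ v$ message to $\mathtt{lead}(v)$. It enters a non-initial view $v$ when it receives a quorum certificate (QC) for view $v-1$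 while in no view or in a view $<v$. When $\mathtt{lead}(v)$, $v$ initial, has first received $\mathtt{view}\ v$ messages from $t+1$ distinct processors, it combines them into a view certificate (VC) for view $v$ and sends it to all processors. A processor that receives a VC for view $v$ or a QC for view $v-1$ while its clock is below $c_v$ instantaneously forwards its clock to $c_v$. **The underlying protocol** is any protocol with these properties. A QC for view $v$ combines signatures of $n-t$ processors, and correct processors sign for view $v$ only while in view $v$; if $\mathtt{lead}(v)$ is correct, it is the one who produces the QC for view $v$, and it sends it to all processors. If $\mathtt{lead}(v)$ is correct, $s\ge GST$, and at least $n-t$ correct processors are in view $v$ from time $s$ until either they receive a QC for view $v$ or until $s+x\delta$, then all correct processors receive a QC for view $v$ by time $s+x\delta$. Correct processors (combined) send at most $Bn$ messages of the underlying protocol per view, for a constant $B$, and they send the messages of a view while they are in that view, except that a leader may send out the QC that it produces at any time. **Theorem.** Let $t^{*}$ be the least time $>GST$ at which some correct $\mathtt{lead}(v)$ produces a QC for view $v$ ($\infty$ if there is none). There is a constant $C$, depending only on $k$, $x$ and $B$, such that every such execution satisfies the following. 1. *(View monotonicity.)* If a correct processor is in view $v$ at time $s$ and in view $v'$ at time $s'\ge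 s$, then $v'\ge v$. 2. *(Eventual synchronisation.)* There are a view $v$ with correct leader, which no correct processor has reached by $GST$, and a time $s\ge GST$ such that each correct processor is in view $v$ from time $s$ until either it receives a QC for view $v$ or until $s+\Gamma$. 3. *(Word complexity.)* The number of words (messages) sent by correct processors, combined, strictly between $GST+2\delta$ and $t^{*}$ is at most $C(fn+n)$. (In particular, if $2\delta\le\Delta$, this bounds the number of words sent strictly between $GST+\Delta$ and $t^{*}$.) 4. *(Latency.)* If at least one correct processor, and in the case $f=0$ at least $t+1$ correct processors, have begun the execution by $GST$, then $t^{*}-GST\le C(\Delta f+\delta)$. -/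

import Mathlib

namespace Fever

/-- The resilience `t`: the largest integer `< n / 3` (for `n ≥ 1`). -/
def resilience (n : ℕ) : ℕ := (n - 1) / 3

theorem resilience_isGreatest (n : ℕ) (hn : 0 < n) :
    IsGreatest {m : ℕ | (m : ℚ) < (n : ℚ) / 3} (resilience n) := by
  have key : ∀ m : ℕ, (m : ℚ) < (n : ℚ) / 3 ↔ 3 * m < n := by
    intro m
    rw [lt_div_iff₀ (by norm_num)]
    constructor
    · intro h
      have h' : ((m * 3 : ℕ) : ℚ) < (n : ℚ) := by push_cast; exact h
      have := Nat.cast_lt.mp h'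
      omega
    · intro h
      have h' : ((3 * m : ℕ) : ℚ) < (n : ℚ) := Nat.cast_lt.mpr h
      push_cast at h'
      linarith
  refine ⟨?_, ?_⟩
  · rw [Set.mem_ofPred_eq, key, resilience]
    omega
  · intro m hm
    rw [Set.mem_ofPred_eq, key] at hm
    rw [resilience]
    omega

/-- The leader of view `v` is processor `⌊v / k⌋ mod n`. -/
def lead (n k : ℕ) [NeZero n] (v : ℕ) : Fin n := Fin.ofNat n (v / k)

/-- A view is initial if it is divisible by `k`. -/
def Initial (k v : ℕ) : Prop := v % k = 0

/-- The clock-time `c_v = Γ v` of view `v`. -/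
def clockTime (Γ : ℝ) (v : ℕ) : ℝ := Γ * v

/-- Message contents. Each message is one word.
* `view v`: the signed message `view v`;
* `vc v`: a view certificate for view `v`;
* `under w q`: a message of the underlying protocol that belongs to the instructions of view `w`;
  if `q = some v`, the message carries a quorum certificate for view `v`. -/
inductive Content : Type
  | view (v : ℕ)
  | vc (v : ℕ)
  | under (w : ℕ) (q : Option ℕ)

/-- The record of an execution with processors `Fin n`: which processors are Byzantine (corrupted
at any point), the global stabilisation time, the clock and the present view of each processor at
each time (`⊥`: in no view yet), and all messages, with their times of sending and of arrival.
The values at time `τ` are those after everything that happens at time `τ`.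
Time starts at `0`. -/
structure Execution (n : ℕ) where
  byz : Finset (Fin n)
  gst : ℝ
  clock : Fin n → ℝ → ℝ
  view : Fin n → ℝ → WithBot ℕ
  Msg : Type
  src : Msg → Fin n
  dst : Msg → Fin n
  content : Msg → Content
  sent : Msg → ℝ
  recv : Msg → ℝ

namespace Execution

variable {n : ℕ} (E : Execution n)

/-- A processor is correct if it is not Byzantine. -/
def Correct (p : Fin n) : Prop := p ∉ E.byz

/-- The message `m` carries a QC for view `v`. -/
def CarriesQC (m : E.Msg) (v : ℕ) : Prop := ∃ w, E.content m = Content.under w (some v)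

/-- At time `τ`, processor `p` receives a QC for view `v`. -/
def RecvQC (p : Fin n) (v : ℕ) (τ : ℝ) : Prop :=
  ∃ m, E.dst m = p ∧ E.recv m = τ ∧ E.CarriesQC m v

/-- By time `τ`, processor `p` has received a QC for view `v`. -/
def HasQC (p : Fin n) (v : ℕ) (τ : ℝ) : Prop := ∃ s ≤ τ, E.RecvQC p v s

/-- At time `τ`, processor `p` receives a VC for view `v`. -/
def RecvVC (p : Fin n) (v : ℕ) (τ : ℝ) : Prop :=
  ∃ m, E.dst m = p ∧ E.recv m = τ ∧ E.content m = Content.vc v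

/-- At time `τ`, processor `p` receives a certificate that makes it forward its clock to the
clock-time of view `v` if its clock is behind: a VC for view `v` or a QC for view `v - 1`. -/
def RecvCert (p : Fin n) (v : ℕ) (τ : ℝ) : Prop :=
  E.RecvVC p v τ ∨ ∃ u, v = u + 1 ∧ E.RecvQC p u τ

/-- The processors whose `view v` messages have been received by `p` by time `τ`. -/
def viewSenders (p : Fin n) (v : ℕ) (τ : ℝ) : Set (Fin n) :=
  {q | ∃ m, E.src m = q ∧ E.dst m = p ∧ E.content m = Content.view v ∧ E.recv m ≤ τ}

/-- `p` sends a message with content `c` to `d` at time `τ`. -/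
def Sends (p d : Fin n) (c : Content) (τ : ℝ) : Prop :=
  ∃ m, E.src m = p ∧ E.dst m = d ∧ E.content m = c ∧ E.sent m = τ

/-- `lead(v)` produces a QC for view `v` at time `τ`: this is when it first sends one. -/
def Produces [NeZero n] (k v : ℕ) (τ : ℝ) : Prop :=
  IsLeast {s | ∃ m, E.src m = lead n k v ∧ E.CarriesQC m v ∧ E.sent m = s} τ

/-- Partial synchrony with point-to-point authenticated channels, and delays of at most `δ`
after GST: a message between correct processors that is sent at time `τ` arrives by
`max GST τ + δ`. Messages arrive strictly after they are sent, no message is lost, and only finitely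
many messages are sent in bounded time. -/
structure PartialSynchrony (δ : ℝ) : Prop where
  gst_nonneg : 0 ≤ E.gst
  sent_nonneg : ∀ m, 0 ≤ E.sent m
  sent_lt_recv : ∀ m, E.sent m < E.recv m
  delay : ∀ m, E.Correct (E.src m) → E.Correct (E.dst m) → E.recv m ≤ max E.gst (E.sent m) + δ
  finite_sent : ∀ T : ℝ, {m | E.sent m ≤ T}.Finite

/-- Partial initial clock synchronisation with bound `Γ`. Every correct processor begins the
protocol execution when its clock reads `0`; the execution starts at time `0`, when clocks of
processors that still have to begin are negative. For each correct `p`, at least `t + 1` correct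
processors (`p` included) have clocks that are at most `Γ` behind the clock of `p`. -/
structure PartialInitialClockSync (Γ : ℝ) : Prop where
  clock_zero_nonpos : ∀ p, E.Correct p → E.clock p 0 ≤ 0
  clock_zero_sync : ∀ p, E.Correct p →
    resilience n + 1 ≤ {q | E.Correct q ∧ E.clock p 0 - Γ ≤ E.clock q 0}.ncard

/-- The correct processors follow the instructions of Fever, and threshold signatures cannot be
forged. -/
structure FollowsFever [NeZero n] (k : ℕ) (Γ : ℝ) : Prop where
  /-- Clocks run at speed one, and are forwarded instantaneously, by certificates only. -/
  clock_step : ∀ p, E.Correct p → ∀ a b : ℝ, 0 ≤ a → a < b →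
    (∀ s, a < s → s < b → ∀ v, ¬ E.RecvCert p v s) →
    IsGreatest ({E.clock p a + (b - a)} ∪ {c | ∃ v, E.RecvCert p v b ∧ c = clockTime Γ v})
      (E.clock p b)
  /-- A processor whose clock is still negative at the start is in no view. -/
  view_start : ∀ p, E.Correct p → E.clock p 0 < 0 → E.view p 0 = ⊥
  /-- An initial view is entered when the clock equals its clock-time. -/
  view_initial : ∀ p, E.Correct p → ∀ v, Initial k v → ∀ τ : ℝ, 0 ≤ τ →
    E.clock p τ = clockTime Γ v → E.view p τ = (v : WithBot ℕ)
  /-- A non-initial view `u + 1` is entered on receipt of a QC for view `u`, if the present view is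
  lower. There is no other reason for a change of view. -/
  view_step : ∀ p, E.Correct p → ∀ a b : ℝ, 0 ≤ a → a < b →
    (∀ s, a < s → s < b →
      (∀ v, Initial k v → E.clock p s ≠ clockTime Γ v) ∧ (∀ u, ¬ E.RecvQC p u s)) →
    (∀ v, Initial k v → E.clock p b ≠ clockTime Γ v) →
    IsGreatest ({E.view p a} ∪
        {w | ∃ u : ℕ, ¬ Initial k (u + 1) ∧ E.RecvQC p u b ∧ w = ((u + 1 : ℕ) : WithBot ℕ)})
      (E.view p b)
  /-- On entering an initial view `v` (and at no other time) a processor sends `view v`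
  to `lead(v)`. -/
  view_message : ∀ p, E.Correct p → ∀ (d : Fin n) (v : ℕ) (τ : ℝ),
    E.Sends p d (Content.view v) τ ↔
      0 ≤ τ ∧ Initial k v ∧ d = lead n k v ∧ E.clock p τ = clockTime Γ v
  /-- A VC for an initial view `v` is sent by `lead(v)`, to all processors, when it has first
  received `view v` messages from `t + 1` processors. -/
  vc_message : ∀ p, E.Correct p → ∀ (d : Fin n) (v : ℕ) (τ : ℝ),
    E.Sends p d (Content.vc v) τ ↔
      Initial k v ∧ p = lead n k v ∧
        IsLeast {s : ℝ | resilience n + 1 ≤ (E.viewSenders p v s).ncard} τ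
  /-- Each of these messages is sent once. -/
  once : ∀ m m' v, E.Correct (E.src m) → (E.content m = Content.view v ∨ E.content m = Content.vc v) →
    E.src m = E.src m' → E.dst m = E.dst m' → E.content m = E.content m' →
    E.sent m = E.sent m' → m = m'
  /-- A VC for view `v`, whoever sends it, combines the signatures of `t + 1` processors, and
  those of correct processors come from their `view v` messages. -/
  vc_sound : ∀ m v, E.content m = Content.vc v →
    ∃ S : Finset (Fin n), resilience n + 1 ≤ S.card ∧ ∀ q ∈ S, E.Correct q →
      ∃ m', E.src m' = q ∧ E.content m' = Content.view v ∧ E.sent m' ≤ E.sent m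

/-- `p` is in view `v` from time `a` until either it receives a QC for view `v` or until time `b`. -/
def InViewUntilQC (p : Fin n) (v : ℕ) (a b : ℝ) : Prop :=
  ∀ τ, a ≤ τ → τ < b → E.view p τ = (v : WithBot ℕ) ∨ E.HasQC p v τ

/-- The properties of the underlying protocol: `x δ` is the time that suffices for the completion of
a view, and `B n` bounds the number of messages of correct processors per view. -/
structure UnderlyingProtocol [NeZero n] (k : ℕ) (x δ : ℝ) (B : ℕ) : Prop where
  /-- A QC for view `v`, whoever sends it, combines signatures of `n - t` processors; a correct
  processor only signs while it is in view `v`. -/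
  qc_sound : ∀ m v, E.CarriesQC m v →
    ∃ S : Finset (Fin n), n - resilience n ≤ S.card ∧ ∀ q ∈ S, E.Correct q →
      ∃ s, 0 ≤ s ∧ s ≤ E.sent m ∧ E.view q s = (v : WithBot ℕ)
  /-- The signatures go to the leader: if `lead(v)` is correct, there is no QC for view `v` before
  `lead(v)` has produced one. -/
  qc_leader : ∀ m v, E.Correct (lead n k v) → E.CarriesQC m v →
    ∃ m', E.src m' = lead n k v ∧ E.CarriesQC m' v ∧ E.sent m' ≤ E.sent m
  /-- A correct leader that produces a QC sends it to all processors. -/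
  qc_broadcast : ∀ v τ, E.Correct (lead n k v) → E.Produces k v τ →
    ∀ d, ∃ m, E.src m = lead n k v ∧ E.dst m = d ∧ E.CarriesQC m v ∧ E.sent m = τ
  /-- Sufficient time for view completion. -/
  sufficient_time : ∀ (v : ℕ) (a : ℝ), E.Correct (lead n k v) → E.gst ≤ a →
    (∃ S : Finset (Fin n), n - resilience n ≤ S.card ∧
      ∀ p ∈ S, E.Correct p ∧ E.InViewUntilQC p v a (a + x * δ)) →
    ∀ p, E.Correct p → E.HasQC p v (a + x * δ)
  /-- A correct processor sends messages of view `w` while in view `w`, except that a leader may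
  send out the QC that it produces for its view `w` at any time. -/
  in_view : ∀ m w q, E.Correct (E.src m) → E.content m = Content.under w q →
    E.view (E.src m) (E.sent m) = (w : WithBot ℕ) ∨
      (q = some w ∧ E.src m = lead n k w ∧ E.Produces k w (E.sent m))
  /-- Correct processors (combined) send `O(n)` messages per view. -/
  linear : ∀ w, {m | E.Correct (E.src m) ∧ ∃ q, E.content m = Content.under w q}.encard ≤
    ((B * n : ℕ) : ℕ∞)

/-- The executions of Fever, run with an underlying protocol, that the theorem is about: at most
`t` Byzantine processors, delays of at most `δ ≤ Δ` after GST, and partial initial clock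
synchronisation with `Γ = x Δ`. -/
structure IsFeverExecution [NeZero n] (k : ℕ) (x : ℝ) (B : ℕ) (Δ δ : ℝ) : Prop where
  delta_pos : 0 < δ
  delta_le : δ ≤ Δ
  byz_card : E.byz.card ≤ resilience n
  network : E.PartialSynchrony δ
  clocks : E.PartialInitialClockSync (x * Δ)
  fever : E.FollowsFever k (x * Δ)
  underlying : E.UnderlyingProtocol k x δ B

/-- View synchronisation, condition (1): views of correct processors never decrease. -/
def ViewMonotone : Prop :=
  ∀ p, E.Correct p → ∀ τ τ' : ℝ, 0 ≤ τ → τ ≤ τ' → E.view p τ ≤ E.view p τ'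

/-- View synchronisation, condition (2): for some view `v` with correct leader and some time
`a ≥ GST`, each correct processor is in view `v` from time `a` until either it receives a QC for
view `v` or until `a + Γ`. The view `v` is moreover one that no correct processor has
reached by GST. -/
def EventuallySynchronised [NeZero n] (k : ℕ) (Γ : ℝ) : Prop :=
  ∃ (v : ℕ) (a : ℝ), E.Correct (lead n k v) ∧ E.gst ≤ a ∧
    (∀ p, E.Correct p → E.view p E.gst < (v : WithBot ℕ)) ∧
    ∀ p, E.Correct p → E.InViewUntilQC p v a (a + Γ)

/-- The time `t*`: the least time `> GST` at which some correct `lead(v)` produces a QC for view `v`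
(`⊤` if there is no such time). -/
noncomputable def firstQC [NeZero n] (k : ℕ) : EReal :=
  sInf {τ : EReal | ∃ (r : ℝ) (v : ℕ),
    τ = (r : EReal) ∧ E.gst < r ∧ E.Correct (lead n k v) ∧ E.Produces k v r}

/-- The latency `t* - GST`. -/
noncomputable def latency [NeZero n] (k : ℕ) : EReal := E.firstQC k - (E.gst : EReal)

/-- The number of words sent by correct processors (combined) between time `a` and `t*`. -/
noncomputable def wordsFrom [NeZero n] (k : ℕ) (a : ℝ) : ℕ∞ :=
  {m | E.Correct (E.src m) ∧ a < E.sent m ∧ (E.sent m : EReal) < E.firstQC k}.encard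

/-- The number of correct processors that have begun the protocol execution by GST. -/
noncomputable def begunByGST : ℕ := {p | E.Correct p ∧ 0 ≤ E.clock p E.gst}.ncard

end Execution

end Fever

/-! ### The evolution of a single clock and a single view. -/

namespace Fever

/-! The core is an invariant: each correct clock always has `t + 1` correct clocks at most Γ behind
it (`exists_quorum_clock`). A VC traces back to a correct clock that showed the same value earlier,
and a QC for `u` has `t + 1` correct signers whose clocks are past `c_u`. Hence, once a correct
clock is Γ past an initial view, `t + 1` correct processors have really entered it
(`quorumReaches_of_clock`). After GST a correct leader then brings everyone there within 2δ.

As long as no QC for an initial view `v` or a later one exists, clocks past `c_v` gain only real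
time since the first entry (`exists_reaches_of_no_qc`). In a block with correct leader that is new
after GST, everyone enters within Γ + 2δ ≤ 2Γ of the first entry, and a QC follows within xδ ≤ Γ,
whereas without a QC the block lasts kΓ ≥ 3Γ. So every such block yields a QC
(`exists_produces_of_clock`).

Among `f + 1` consecutive blocks one has a correct leader. Let `b` be the first block that no
correct clock has reached by GST. Then t* comes before any correct clock passes block `b + f`, and
by GST + 2δ everyone is at block `b - 2 - f` or later. At most `2f + 3` blocks thus contribute
words, and clocks of speed at least one give latency O(Δf) for `f > 0`.

For `f = 0`, suppose that no QC is produced for a while after GST. All QCs are then old and soon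
known, so `t + 1` processors enter a further block every (2 + x)δ (`quorumReaches_succ`). Without
new QCs clocks cannot move that fast, and four blocks suffice for a contradiction.

Evolution in time is handled by induction over a locally finite set of events, causality by
`message_induction`. -/

theorem event_induction {F : Set ℝ} (hF : ∀ T, (F ∩ Set.Iic T).Finite) {P : ℝ → Prop}
    (zero : P 0)
    (step : ∀ a b, 0 ≤ a → a < b → (∀ s, a < s → s < b → s ∉ F) → P a → P b) :
    ∀ τ, 0 ≤ τ → P τ := by
  have key : ∀ N : ℕ, ∀ τ, 0 ≤ τ → (F ∩ Set.Ioo 0 τ).ncard = N → P τ := by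
    intro N
    induction N using Nat.strong_induction_on with
    | _ N ih =>
      intro τ hτ hN
      have hfin : (F ∩ Set.Ioo 0 τ).Finite :=
        (hF τ).subset fun s hs => ⟨hs.1, hs.2.2.le⟩
      rcases hτ.eq_or_lt with rfl | hτ
      · exact zero
      rcases (F ∩ Set.Ioo 0 τ).eq_empty_or_nonempty with he | hne
      · exact step 0 τ le_rfl hτ
          (fun s h1 h2 h3 => he.subset (⟨h3, h1, h2⟩ : s ∈ F ∩ Set.Ioo 0 τ)) zero
      · obtain ⟨a, ha, hmax⟩ := Set.exists_max_image _ id hfin hne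
        refine step a τ ha.2.1.le ha.2.2 (fun s h1 h2 h3 => ?_) ?_
        · exact absurd (hmax s ⟨h3, ha.2.1.trans h1, h2⟩) (not_le.2 h1)
        · refine ih _ ?_ a ha.2.1.le rfl
          rw [← hN]
          refine Set.ncard_lt_ncard ⟨fun s hs => ⟨hs.1, hs.2.1, hs.2.2.trans ha.2.2⟩, ?_⟩ hfin
          exact fun hsub => lt_irrefl a (hsub ha).2.2
  exact fun τ hτ => key _ τ hτ rfl

theorem clockTime_le_clockTime {Γ : ℝ} (hΓ : 0 < Γ) {v w : ℕ} :
    clockTime Γ v ≤ clockTime Γ w ↔ v ≤ w := by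
  rw [clockTime, clockTime, mul_le_mul_iff_right₀ hΓ, Nat.cast_le]

theorem clockTime_nonneg {Γ : ℝ} (hΓ : 0 < Γ) (v : ℕ) : 0 ≤ clockTime Γ v :=
  mul_nonneg hΓ.le v.cast_nonneg

theorem clockTime_add (Γ : ℝ) (v w : ℕ) :
    clockTime Γ (v + w) = clockTime Γ v + Γ * w := by
  simp only [clockTime, Nat.cast_add]; ring

theorem clockTime_zero (Γ : ℝ) : clockTime Γ 0 = 0 := by simp [clockTime]

namespace Execution

variable {n : ℕ} {E : Execution n}

namespace PartialSynchrony

variable {δ : ℝ}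

theorem finite_recv (h : E.PartialSynchrony δ) (T : ℝ) : {m | E.recv m ≤ T}.Finite :=
  (h.finite_sent T).subset fun m hm => (h.sent_lt_recv m).le.trans hm

theorem recv_pos (h : E.PartialSynchrony δ) (m : E.Msg) : 0 < E.recv m :=
  (h.sent_nonneg m).trans_lt (h.sent_lt_recv m)

/-- The number of messages sent before a given time is finite, and it drops on passing to the
sending time of one of them. This makes tracing certificates back to their origin well-founded. -/
theorem message_induction (h : E.PartialSynchrony δ) {P : ℝ → Prop}
    (step : ∀ τ, (∀ m, E.sent m < τ → P (E.sent m)) → P τ) (τ : ℝ) : P τ := by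
  have key : ∀ N : ℕ, ∀ τ, {m | E.sent m < τ}.ncard = N → P τ := by
    intro N
    induction N using Nat.strong_induction_on with
    | _ N ih =>
      intro τ hN
      refine step τ fun m hm => ih _ ?_ _ rfl
      rw [← hN]
      refine Set.ncard_lt_ncard ⟨fun m' hm' => lt_trans hm' hm, fun hsub => ?_⟩
        ((h.finite_sent τ).subset fun m' hm' => (le_of_lt hm' : E.sent m' ≤ τ))
      exact lt_irrefl (E.sent m) (hsub hm)
  exact key _ τ rfl

end PartialSynchrony

theorem exists_msg_of_recvCert {p : Fin n} {v : ℕ} {s : ℝ} (h : E.RecvCert p v s) :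
    ∃ m, E.recv m = s := by
  rcases h with ⟨m, -, hm, -⟩ | ⟨u, -, m, -, hm, -⟩
  exacts [⟨m, hm⟩, ⟨m, hm⟩]

variable {Γ : ℝ}

/-- `p` reads the clock-time of view `v` at some time up to `τ`. -/
def Reaches (E : Execution n) (Γ : ℝ) (p : Fin n) (v : ℕ) (τ : ℝ) : Prop :=
  ∃ s, 0 ≤ s ∧ s ≤ τ ∧ E.clock p s = clockTime Γ v

/-- At least `t + 1` correct processors read the clock-time of view `v` up to time `τ`. -/
def QuorumReaches (E : Execution n) (Γ : ℝ) (v : ℕ) (τ : ℝ) : Prop :=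
  ∃ S : Finset (Fin n), resilience n + 1 ≤ S.card ∧
    ∀ q ∈ S, E.Correct q ∧ E.Reaches Γ q v τ

theorem Reaches.mono {p : Fin n} {v : ℕ} {s τ : ℝ} (h : E.Reaches Γ p v s) (hs : s ≤ τ) :
    E.Reaches Γ p v τ := by
  obtain ⟨r, h0, h1, h2⟩ := h
  exact ⟨r, h0, h1.trans hs, h2⟩

theorem QuorumReaches.mono {v : ℕ} {s τ : ℝ} (h : E.QuorumReaches Γ v s) (hs : s ≤ τ) :
    E.QuorumReaches Γ v τ := by
  obtain ⟨S, h1, h2⟩ := h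
  exact ⟨S, h1, fun q hq => ⟨(h2 q hq).1, (h2 q hq).2.mono hs⟩⟩

namespace IsFeverExecution

variable [NeZero n] {k B : ℕ} {x Δ δ : ℝ} {p : Fin n} {τ : ℝ}

/-- The clock shows the largest of the values that result from the start and from the
certificates received so far. -/
theorem clock_spec (h : E.IsFeverExecution k x B Δ δ) (hp : E.Correct p) (hτ : 0 ≤ τ) :
    (∀ s, 0 ≤ s → s ≤ τ → E.clock p s + (τ - s) ≤ E.clock p τ) ∧
    (∀ v s, s ≤ τ → E.RecvCert p v s → clockTime (x * Δ) v + (τ - s) ≤ E.clock p τ) ∧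
    (E.clock p τ = E.clock p 0 + τ ∨ ∃ v s, 0 ≤ s ∧ s ≤ τ ∧ E.RecvCert p v s ∧
      E.clock p τ = clockTime (x * Δ) v + (τ - s)) := by
  have hF : ∀ T, ({s | ∃ v, E.RecvCert p v s} ∩ Set.Iic T).Finite := by
    intro T
    refine ((h.network.finite_recv T).image E.recv).subset ?_
    rintro s ⟨⟨v, hv⟩, hs⟩
    obtain ⟨m, rfl⟩ := exists_msg_of_recvCert hv
    exact ⟨m, hs, rfl⟩
  refine event_induction (P := fun τ =>
    (∀ s, 0 ≤ s → s ≤ τ → E.clock p s + (τ - s) ≤ E.clock p τ) ∧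
    (∀ v s, s ≤ τ → E.RecvCert p v s → clockTime (x * Δ) v + (τ - s) ≤ E.clock p τ) ∧
    (E.clock p τ = E.clock p 0 + τ ∨ ∃ v s, 0 ≤ s ∧ s ≤ τ ∧ E.RecvCert p v s ∧
      E.clock p τ = clockTime (x * Δ) v + (τ - s))) hF ?_ ?_ τ hτ
  · refine ⟨fun s h0 h1 => ?_, fun v s hs hc => ?_, Or.inl (by ring)⟩
    · obtain rfl : s = 0 := le_antisymm h1 h0
      simp
    · obtain ⟨m, rfl⟩ := exists_msg_of_recvCert hc
      exact absurd hs (not_le.2 (h.network.recv_pos m))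
  · intro a b ha hab hno ⟨ih1, ih2, ih3⟩
    -- As no certificate arrives strictly between `a` and `b`, the clock rule applies from every `s`
    -- in between, not only from `a`.
    have hstep : ∀ s, a ≤ s → s < b → IsGreatest ({E.clock p s + (b - s)} ∪
        {c | ∃ v, E.RecvCert p v b ∧ c = clockTime (x * Δ) v}) (E.clock p b) := fun s h1 h2 =>
      h.fever.clock_step p hp s b (ha.trans h1) h2
        fun r hr hr' v hv => hno r (h1.trans_lt hr) hr' ⟨v, hv⟩
    refine ⟨fun s h0 h1 => ?_, fun v s hs hc => ?_, ?_⟩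
    · rcases h1.eq_or_lt with rfl | h1
      · simp
      rcases le_total s a with h2 | h2
      · have := ih1 s h0 h2
        have := (hstep a le_rfl hab).2 (Or.inl rfl)
        linarith
      · exact (hstep s h2 h1).2 (Or.inl rfl)
    · rcases hs.eq_or_lt with rfl | hs
      · have := (hstep a le_rfl hab).2 (Or.inr ⟨v, hc, rfl⟩)
        linarith
      · rcases le_or_gt s a with h2 | h2
        · have := ih2 v s h2 hc
          have := (hstep a le_rfl hab).2 (Or.inl rfl)
          linarith
        · exact absurd ⟨v, hc⟩ (hno s h2 hs)
    · rcases (hstep a le_rfl hab).1 with h1 | ⟨v, hv, h1⟩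
      · rw [Set.mem_singleton_iff] at h1
        rcases ih3 with h2 | ⟨v, s, h0, hs, hc, h2⟩
        · left; linarith
        · exact Or.inr ⟨v, s, h0, hs.trans hab.le, hc, by linarith⟩
      · exact Or.inr ⟨v, b, ha.trans hab.le, le_rfl, hv, by linarith⟩

theorem gamma_pos (h : E.IsFeverExecution k x B Δ δ) (hx : 2 ≤ x) : 0 < x * Δ :=
  mul_pos (by linarith) (h.delta_pos.trans_le h.delta_le)

theorem clock_add_le (h : E.IsFeverExecution k x B Δ δ) (hp : E.Correct p) {s : ℝ}
    (hs : 0 ≤ s) (hsτ : s ≤ τ) : E.clock p s + (τ - s) ≤ E.clock p τ :=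
  (h.clock_spec hp (hs.trans hsτ)).1 s hs hsτ

theorem clock_mono (h : E.IsFeverExecution k x B Δ δ) (hp : E.Correct p) {s : ℝ}
    (hs : 0 ≤ s) (hsτ : s ≤ τ) : E.clock p s ≤ E.clock p τ := by
  have := h.clock_add_le hp hs hsτ
  linarith

theorem clockTime_le_clock_of_recvCert (h : E.IsFeverExecution k x B Δ δ) (hp : E.Correct p)
    {s : ℝ} {v : ℕ} (hc : E.RecvCert p v s) (hsτ : s ≤ τ) :
    clockTime (x * Δ) v ≤ E.clock p τ := by
  obtain ⟨m, rfl⟩ := exists_msg_of_recvCert hc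
  have := (h.clock_spec hp ((h.network.recv_pos m).le.trans hsτ)).2.1 v _ hsτ hc
  linarith

theorem eq_of_clock_eq (h : E.IsFeverExecution k x B Δ δ) (hp : E.Correct p) {s : ℝ}
    (hs : 0 ≤ s) (hτ : 0 ≤ τ) (he : E.clock p s = E.clock p τ) : s = τ := by
  rcases le_total s τ with h1 | h1
  · have := h.clock_add_le hp hs h1
    linarith
  · have := h.clock_add_le hp hτ h1
    linarith

/-- The present view has a cause, and every cause so far is a lower bound for it; causes persist,
which gives monotonicity. Entering an initial view overrides the present view but does not lower it,
since every earlier cause has a clock-time at most the current clock. -/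
theorem view_spec (h : E.IsFeverExecution k x B Δ δ) (hx : 2 ≤ x) (hp : E.Correct p)
    (hτ : 0 ≤ τ) :
    (∀ w : ℕ, E.view p τ = w → clockTime (x * Δ) w ≤ E.clock p τ ∧
      (Initial k w ∧ E.Reaches (x * Δ) p w τ ∨
        ¬ Initial k w ∧ ∃ u s, w = u + 1 ∧ s ≤ τ ∧ E.RecvQC p u s)) ∧
    (∀ v, Initial k v → E.Reaches (x * Δ) p v τ → (v : WithBot ℕ) ≤ E.view p τ) ∧
    (∀ u s, ¬ Initial k (u + 1) → s ≤ τ → E.RecvQC p u s →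
      ((u + 1 : ℕ) : WithBot ℕ) ≤ E.view p τ) := by
  have hΓ := h.gamma_pos hx
  have hF : ∀ T, ({s | 0 ≤ s ∧ ((∃ v, Initial k v ∧ E.clock p s = clockTime (x * Δ) v) ∨
      ∃ u, E.RecvQC p u s)} ∩ Set.Iic T).Finite := by
    intro T
    -- The clock is strictly increasing, so up to `T` it shows finitely many clock-times, each at
    -- most once.
    obtain ⟨N, hN⟩ := exists_nat_gt (E.clock p T / (x * Δ))
    rw [div_lt_iff₀ hΓ] at hN
    have hfin : (⋃ v ∈ Finset.range N, {s | 0 ≤ s ∧ E.clock p s = clockTime (x * Δ) v}).Finite :=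
      Set.Finite.biUnion (Finset.finite_toSet _) fun v _ =>
        Set.Subsingleton.finite fun s hs r hr =>
          h.eq_of_clock_eq hp hs.1 hr.1 (hs.2.trans hr.2.symm)
    refine (((h.network.finite_recv T).image E.recv).union hfin).subset ?_
    rintro s ⟨⟨h0, ⟨v, -, hv⟩ | ⟨u, m, -, rfl, -⟩⟩, hs⟩
    · right
      simp only [Set.mem_iUnion, Finset.mem_range]
      refine ⟨v, ?_, h0, hv⟩
      have h1 := h.clock_mono hp h0 hs
      rw [hv, clockTime] at h1
      have : (v : ℝ) < N := by nlinarith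
      exact_mod_cast this
    · exact Or.inl ⟨m, hs, rfl⟩
  have atInit : ∀ b v, 0 ≤ b → Initial k v → E.clock p b = clockTime (x * Δ) v →
    (∀ w : ℕ, E.view p b = w → clockTime (x * Δ) w ≤ E.clock p b ∧
      (Initial k w ∧ E.Reaches (x * Δ) p w b ∨
        ¬ Initial k w ∧ ∃ u s, w = u + 1 ∧ s ≤ b ∧ E.RecvQC p u s)) ∧
    (∀ v, Initial k v → E.Reaches (x * Δ) p v b → (v : WithBot ℕ) ≤ E.view p b) ∧
    (∀ u s, ¬ Initial k (u + 1) → s ≤ b → E.RecvQC p u s →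
      ((u + 1 : ℕ) : WithBot ℕ) ≤ E.view p b) := by
    intro b v hb hv hc
    have hview := h.fever.view_initial p hp v hv b hb hc
    rw [hview]
    refine ⟨fun w hw => ?_, fun v' _ hv' => ?_, fun u s _ hs hq => ?_⟩
    · obtain rfl : v = w := by exact_mod_cast hw
      exact ⟨hc.ge, Or.inl ⟨hv, b, hb, le_rfl, hc⟩⟩
    · obtain ⟨s, h0, hs, he⟩ := hv'
      have := h.clock_mono hp h0 hs
      rw [he, hc, clockTime_le_clockTime hΓ] at this
      exact_mod_cast this
    · have := h.clockTime_le_clock_of_recvCert hp (Or.inr ⟨u, rfl, hq⟩) hs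
      rw [hc, clockTime_le_clockTime hΓ] at this
      exact_mod_cast this
  refine event_induction (P := fun b => (∀ w : ℕ, E.view p b = w →
      clockTime (x * Δ) w ≤ E.clock p b ∧ (Initial k w ∧ E.Reaches (x * Δ) p w b ∨
        ¬ Initial k w ∧ ∃ u s, w = u + 1 ∧ s ≤ b ∧ E.RecvQC p u s)) ∧
    (∀ v, Initial k v → E.Reaches (x * Δ) p v b → (v : WithBot ℕ) ≤ E.view p b) ∧
    (∀ u s, ¬ Initial k (u + 1) → s ≤ b → E.RecvQC p u s →
      ((u + 1 : ℕ) : WithBot ℕ) ≤ E.view p b)) hF ?_ ?_ τ hτ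
  · rcases (h.clocks.clock_zero_nonpos p hp).eq_or_lt with h0 | h0
    · exact atInit 0 0 le_rfl (Nat.zero_mod k) (by rw [h0, clockTime_zero])
    · have hview := h.fever.view_start p hp h0
      rw [hview]
      refine ⟨fun w hw => absurd hw.symm (WithBot.coe_ne_bot), fun v _ hv => ?_,
        fun u s _ hs hq => ?_⟩
      · obtain ⟨s, h1, h2, h3⟩ := hv
        obtain rfl : s = 0 := le_antisymm h2 h1
        have := clockTime_nonneg hΓ v
        linarith
      · obtain ⟨m, -, rfl, -⟩ := hq
        exact absurd hs (not_le.2 (h.network.recv_pos m))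
  · intro a b ha hab hno ⟨ih1, ih2, ih3⟩
    have hb := ha.trans hab.le
    by_cases hbi : ∃ v, Initial k v ∧ E.clock p b = clockTime (x * Δ) v
    · obtain ⟨v, hv, hc⟩ := hbi
      exact atInit b v hb hv hc
    push Not at hbi
    have hs := h.fever.view_step p hp a b ha hab (fun s h1 h2 =>
      ⟨fun v hv hc => hno s h1 h2 ⟨ha.trans h1.le, Or.inl ⟨v, hv, hc⟩⟩,
        fun u hu => hno s h1 h2 ⟨ha.trans h1.le, Or.inr ⟨u, hu⟩⟩⟩) hbi
    have hmono : E.view p a ≤ E.view p b := hs.2 (Or.inl rfl)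
    refine ⟨fun w hw => ?_, fun v hv hr => ?_, fun u s hu hsb hq => ?_⟩
    · rcases hs.1 with h1 | ⟨u, hu, hq, h1⟩
      · rw [Set.mem_singleton_iff, hw] at h1
        obtain ⟨h2, h3⟩ := ih1 w h1.symm
        refine ⟨h2.trans (h.clock_mono hp ha hab.le), ?_⟩
        rcases h3 with ⟨h3, h4⟩ | ⟨h3, u, s, h4, h5, h6⟩
        · exact Or.inl ⟨h3, h4.mono hab.le⟩
        · exact Or.inr ⟨h3, u, s, h4, h5.trans hab.le, h6⟩
      · rw [hw] at h1
        obtain rfl : w = u + 1 := by exact_mod_cast h1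
        exact ⟨h.clockTime_le_clock_of_recvCert hp (Or.inr ⟨u, rfl, hq⟩) le_rfl,
          Or.inr ⟨hu, u, b, rfl, le_rfl, hq⟩⟩
    · obtain ⟨s, h0, hsb, hc⟩ := hr
      rcases le_or_gt s a with h1 | h1
      · exact (ih2 v hv ⟨s, h0, h1, hc⟩).trans hmono
      · rcases hsb.eq_or_lt with rfl | h2
        · exact absurd hc (hbi v hv)
        · exact absurd ⟨h0, Or.inl ⟨v, hv, hc⟩⟩ (hno s h1 h2)
    · rcases le_or_gt s a with h1 | h1
      · exact (ih3 u s hu h1 hq).trans hmono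
      · rcases hsb.eq_or_lt with rfl | h2
        · exact hs.2 (Or.inr ⟨u, hu, hq, rfl⟩)
        · exact absurd ⟨ha.trans h1.le, Or.inr ⟨u, hq⟩⟩ (hno s h1 h2)

theorem clockTime_le_clock_of_view (h : E.IsFeverExecution k x B Δ δ) (hx : 2 ≤ x)
    (hp : E.Correct p) (hτ : 0 ≤ τ) {w : ℕ} (hw : E.view p τ = w) :
    clockTime (x * Δ) w ≤ E.clock p τ :=
  ((h.view_spec hx hp hτ).1 w hw).1

theorem viewMonotone (h : E.IsFeverExecution k x B Δ δ) (hx : 2 ≤ x) : E.ViewMonotone := by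
  intro p hp s τ hs hsτ
  cases hw : E.view p s with
  | bot => exact bot_le
  | coe w =>
    rcases ((h.view_spec hx hp hs).1 w hw).2 with ⟨h1, h2⟩ | ⟨h1, u, r, rfl, h2, h3⟩
    · exact (h.view_spec hx hp (hs.trans hsτ)).2.1 w h1 (h2.mono hsτ)
    · exact (h.view_spec hx hp (hs.trans hsτ)).2.2 u r h1 (h2.trans hsτ) h3

/-- A clock that is past a clock-time has either shown it or was forwarded past it. -/
theorem reaches_or_recvCert (h : E.IsFeverExecution k x B Δ δ) (hp : E.Correct p) (hτ : 0 ≤ τ)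
    {v : ℕ} (hx : 2 ≤ x) (hv : clockTime (x * Δ) v ≤ E.clock p τ) :
    (∃ s, 0 ≤ s ∧ s ≤ τ ∧ E.clock p s = clockTime (x * Δ) v ∧
      E.clock p τ = clockTime (x * Δ) v + (τ - s)) ∨
    ∃ w s, v < w ∧ 0 ≤ s ∧ s ≤ τ ∧ E.RecvCert p w s ∧
      E.clock p τ = clockTime (x * Δ) w + (τ - s) := by
  have hΓ := h.gamma_pos hx
  have key : ∀ s c, 0 ≤ s → s ≤ τ → c ≤ E.clock p s → c ≤ clockTime (x * Δ) v →
      E.clock p τ = c + (τ - s) →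
      ∃ s, 0 ≤ s ∧ s ≤ τ ∧ E.clock p s = clockTime (x * Δ) v ∧
        E.clock p τ = clockTime (x * Δ) v + (τ - s) := by
    intro s c hs hsτ hc hcv he
    -- The clock gains at least real time before and after this moment and no more in total, so here
    -- it shows exactly `c_v`.
    refine ⟨s + (clockTime (x * Δ) v - c), by linarith, by linarith, ?_, by linarith⟩
    have h1 := h.clock_add_le hp hs (τ := s + (clockTime (x * Δ) v - c)) (by linarith)
    have h2 := h.clock_add_le hp (s := s + (clockTime (x * Δ) v - c)) (τ := τ)
      (by linarith) (by linarith)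
    linarith
  rcases (h.clock_spec hp hτ).2.2 with he | ⟨w, s, hs, hsτ, hc, he⟩
  · exact Or.inl (key 0 _ le_rfl hτ le_rfl
      ((h.clocks.clock_zero_nonpos p hp).trans (clockTime_nonneg hΓ v)) (by linarith))
  · rcases le_or_gt w v with hwv | hwv
    · exact Or.inl (key s _ hs hsτ (h.clockTime_le_clock_of_recvCert hp hc le_rfl)
        ((clockTime_le_clockTime hΓ).2 hwv) he)
    · exact Or.inr ⟨w, s, hwv, hs, hsτ, hc, he⟩

end IsFeverExecution

end Execution

end Fever

/-! ### Certificates, quorums and the clock invariant. -/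

namespace Fever

theorem three_mul_resilience_lt (n : ℕ) [NeZero n] : 3 * resilience n < n := by
  have := NeZero.pos n
  rw [resilience]; omega

theorem initial_mul (k j : ℕ) : Initial k (k * j) := Nat.mul_mod_right k j

theorem not_initial_of_lt {k v u : ℕ} (hv : Initial k v) (h1 : v < u) (h2 : u < v + k) :
    ¬ Initial k u := by
  obtain ⟨a, rfl⟩ := Nat.dvd_of_mod_eq_zero hv
  intro h
  obtain ⟨b, rfl⟩ := Nat.dvd_of_mod_eq_zero h
  have h3 : a < b := Nat.lt_of_mul_lt_mul_left h1
  have h4 : k * (a + 1) ≤ k * b := Nat.mul_le_mul_left k h3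
  rw [Nat.mul_add, Nat.mul_one] at h4
  omega

theorem add_le_of_initial {k v u : ℕ} (hv : Initial k v) (hu : Initial k u) (h : v < u) :
    v + k ≤ u := by
  by_contra! hlt
  exact not_initial_of_lt hv h hlt hu

namespace Execution

variable {n : ℕ} {E : Execution n} [NeZero n] {k B : ℕ} {x Δ δ : ℝ}

namespace IsFeverExecution

variable {p : Fin n} {τ : ℝ}

theorem exists_correct_mem (h : E.IsFeverExecution k x B Δ δ) {S : Finset (Fin n)}
    (hS : resilience n + 1 ≤ S.card) : ∃ q ∈ S, E.Correct q := by
  by_contra! hno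
  have : S ⊆ E.byz := fun q hq => not_not.1 (hno q hq)
  have := Finset.card_le_card this
  have := h.byz_card
  omega

theorem exists_correct (h : E.IsFeverExecution k x B Δ δ) : ∃ q, E.Correct q := by
  have := three_mul_resilience_lt n
  obtain ⟨q, -, hq⟩ := h.exists_correct_mem (S := Finset.univ)
    (by rw [Finset.card_univ, Fintype.card_fin]; omega)
  exact ⟨q, hq⟩

/-- One of `t + 1` signers is correct, and it signs only when its clock shows `c_v`. The moment is
given as a sending time to suit `message_induction`. -/
theorem exists_reaches_of_vc (h : E.IsFeverExecution k x B Δ δ) {v : ℕ} {m : E.Msg}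
    (hm : E.content m = Content.vc v) :
    Initial k v ∧ ∃ q m', E.Correct q ∧ E.sent m' ≤ E.sent m ∧
      E.clock q (E.sent m') = clockTime (x * Δ) v := by
  obtain ⟨S, hS, hs⟩ := h.fever.vc_sound m v hm
  obtain ⟨q, hqS, hq⟩ := h.exists_correct_mem hS
  obtain ⟨m', h1, h2, h3⟩ := hs q hqS hq
  obtain ⟨-, h5, -, h6⟩ := (h.fever.view_message q hq (E.dst m') v (E.sent m')).1
    ⟨m', h1, rfl, h2, rfl⟩
  exact ⟨h5, q, m', hq, h3, h6⟩

/-- Removing at most `t` Byzantine signers from `n - t` leaves at least `t + 1`, because `3t < n`.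
-/
theorem exists_quorum_of_qc (h : E.IsFeverExecution k x B Δ δ) {u : ℕ} {m : E.Msg}
    (hm : E.CarriesQC m u) :
    ∃ S : Finset (Fin n), resilience n + 1 ≤ S.card ∧ ∀ q ∈ S, E.Correct q ∧
      ∃ s, 0 ≤ s ∧ s ≤ E.sent m ∧ E.view q s = (u : WithBot ℕ) := by
  obtain ⟨S, hS, hs⟩ := h.underlying.qc_sound m u hm
  refine ⟨S \ E.byz, ?_, fun q hq => ?_⟩
  · have h1 := three_mul_resilience_lt n
    have h2 := h.byz_card
    have h3 := Finset.le_card_sdiff E.byz S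
    omega
  · rw [Finset.mem_sdiff] at hq
    exact ⟨hq.2, hs q hq.1 hq.2⟩

theorem exists_view_of_qc (h : E.IsFeverExecution k x B Δ δ) {u : ℕ} {m : E.Msg}
    (hm : E.CarriesQC m u) :
    ∃ q s, E.Correct q ∧ 0 ≤ s ∧ s ≤ E.sent m ∧ E.view q s = (u : WithBot ℕ) := by
  obtain ⟨S, hS, hs⟩ := h.exists_quorum_of_qc hm
  obtain ⟨q, hq⟩ : S.Nonempty := Finset.card_pos.1 (by omega)
  obtain ⟨h1, s, h2⟩ := hs q hq
  exact ⟨q, s, h1, h2⟩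

/-- A certificate that forwards a clock past an initial view `v` is a QC for a view `≥ v`, or a
VC for a later initial view. -/
theorem qc_or_vc_of_recvCert (h : E.IsFeverExecution k x B Δ δ) {v w : ℕ} {s : ℝ}
    (hv : Initial k v) (hvw : v < w) (hc : E.RecvCert p w s) :
    (∃ u m, v ≤ u ∧ w = u + 1 ∧ E.CarriesQC m u ∧ E.dst m = p ∧ E.recv m = s) ∨
    v + k ≤ w ∧ ∃ q m m', E.Correct q ∧ E.sent m' ≤ E.sent m ∧ E.recv m = s ∧
      E.clock q (E.sent m') = clockTime (x * Δ) w := by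
  rcases hc with ⟨m, h1, h2, h3⟩ | ⟨u, rfl, m, h1, h2, h3⟩
  · obtain ⟨h4, q, m', h5, h6, h7⟩ := h.exists_reaches_of_vc h3
    exact Or.inr ⟨add_le_of_initial hv h4 hvw, q, m, m', h5, h6, h2, h7⟩
  · exact Or.inl ⟨u, m, by omega, rfl, h3, h1, h2⟩

/-- At all times, at least `t + 1` correct clocks are at most `Γ` behind any given correct
clock. -/
theorem exists_quorum_clock (h : E.IsFeverExecution k x B Δ δ) (hx : 2 ≤ x)
    (hp : E.Correct p) (hτ : 0 ≤ τ) :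
    ∃ S : Finset (Fin n), resilience n + 1 ≤ S.card ∧
      ∀ q ∈ S, E.Correct q ∧ E.clock p τ - x * Δ ≤ E.clock q τ := by
  refine h.network.message_induction (P := fun τ => 0 ≤ τ → ∀ p, E.Correct p →
    ∃ S : Finset (Fin n), resilience n + 1 ≤ S.card ∧
      ∀ q ∈ S, E.Correct q ∧ E.clock p τ - x * Δ ≤ E.clock q τ) ?_ τ hτ p hp
  intro τ ih hτ p hp
  rcases (h.clock_spec hp hτ).2.2 with he | ⟨v, s, hs, hsτ, hc, he⟩
  · refine ⟨(Set.toFinite {q | E.Correct q ∧ E.clock p 0 - x * Δ ≤ E.clock q 0}).toFinset,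
      ?_, fun q hq => ?_⟩
    · rw [← Set.ncard_eq_toFinset_card]
      exact h.clocks.clock_zero_sync p hp
    · rw [Set.Finite.mem_toFinset] at hq
      have := h.clock_add_le hq.1 le_rfl hτ
      have := hq.2
      exact ⟨hq.1, by linarith⟩
  · rcases hc with ⟨m, h1, rfl, h3⟩ | ⟨u, rfl, m, h1, rfl, h3⟩
    · obtain ⟨-, q, m', h5, h6, h7⟩ := h.exists_reaches_of_vc h3
      have h8 := h.network.sent_lt_recv m
      have h9 := h.network.sent_nonneg m'
      obtain ⟨S, hS, hs⟩ := ih m' (by linarith) h9 q h5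
      refine ⟨S, hS, fun r hr => ⟨(hs r hr).1, ?_⟩⟩
      have h10 := h.clock_add_le (hs r hr).1 h9 (τ := τ) (by linarith)
      have h11 := (hs r hr).2
      linarith
    -- The correct signers were in view `u`, so their clocks had passed `c_u`, which is exactly Γ
    -- below the new value `c_{u+1}`.
    · obtain ⟨S, hS, hs⟩ := h.exists_quorum_of_qc h3
      refine ⟨S, hS, fun r hr => ?_⟩
      obtain ⟨hr1, s, h4, h5, h6⟩ := hs r hr
      refine ⟨hr1, ?_⟩
      have h7 := h.clockTime_le_clock_of_view hx hr1 h4 h6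
      have h8 := h.network.sent_lt_recv m
      have h10 := h.clock_add_le hr1 h4 (τ := τ) (by linarith)
      rw [he, clockTime_add]
      push_cast
      linarith

/-- A QC for a view requires QCs for the preceding views of its block. -/
theorem exists_qc_of_le (h : E.IsFeverExecution k x B Δ δ) (hx : 2 ≤ x) {v w : ℕ}
    (hv : Initial k v) (hvw : v ≤ w) (d : ℕ) (hd : w + d < v + k) {m : E.Msg}
    (hm : E.CarriesQC m (w + d)) : ∃ m', E.CarriesQC m' w ∧ E.sent m' ≤ E.sent m := by
  induction d generalizing m with
  | zero => exact ⟨m, hm, le_rfl⟩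
  | succ d ih =>
    obtain ⟨q, s, h1, h2, h3, h4⟩ := h.exists_view_of_qc hm
    rcases ((h.view_spec hx h1 h2).1 _ h4).2 with ⟨h5, -⟩ | ⟨-, u, r, h5, h6, m', h7, rfl, h8⟩
    · exact absurd h5 (not_initial_of_lt hv (by omega) hd)
    · obtain rfl : u = w + d := by omega
      obtain ⟨m'', h9, h10⟩ := ih (by omega) h8
      have := h.network.sent_lt_recv m'
      exact ⟨m'', h9, by linarith⟩

/-- By the clock invariant `t + 1` correct clocks are past `c_v`. If one of them jumped over it, the
certificate used goes back to an earlier QC for some `u ≥ v` or an earlier clock past `c_{v+1}`. A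
QC within the block goes back to one for `v`, whose correct signers entered at `c_v`; a later QC has
a correct signer whose clock is past `c_{v+1}`. So the two claims need each other. -/
theorem quorumReaches_aux (h : E.IsFeverExecution k x B Δ δ) (hx : 2 ≤ x) (hk : 1 ≤ k) {v : ℕ}
    (hv : Initial k v) (τ : ℝ) :
    (∀ p, E.Correct p → 0 ≤ τ → clockTime (x * Δ) (v + 1) ≤ E.clock p τ →
      E.QuorumReaches (x * Δ) v τ) ∧
    (∀ m u, E.sent m ≤ τ → E.CarriesQC m u → v ≤ u → E.QuorumReaches (x * Δ) v τ) := by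
  have hΓ := h.gamma_pos hx
  refine h.network.message_induction (P := fun τ =>
    (∀ p, E.Correct p → 0 ≤ τ → clockTime (x * Δ) (v + 1) ≤ E.clock p τ →
      E.QuorumReaches (x * Δ) v τ) ∧
    (∀ m u, E.sent m ≤ τ → E.CarriesQC m u → v ≤ u → E.QuorumReaches (x * Δ) v τ)) ?_ τ
  intro τ ih
  have key : ∀ p, E.Correct p → 0 ≤ τ → clockTime (x * Δ) (v + 1) ≤ E.clock p τ →
      E.QuorumReaches (x * Δ) v τ := by
    intro p hp hτ hc
    obtain ⟨S, hS, hs⟩ := h.exists_quorum_clock hx hp hτ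
    by_cases hall : ∀ q ∈ S, E.Reaches (x * Δ) q v τ
    · exact ⟨S, hS, fun q hq => ⟨(hs q hq).1, hall q hq⟩⟩
    push Not at hall
    obtain ⟨q, hqS, hq⟩ := hall
    have hcq := (hs q hqS).2
    rw [clockTime_add] at hc
    push_cast at hc
    rcases h.reaches_or_recvCert (hs q hqS).1 hτ hx (v := v) (by linarith) with
      ⟨s, h0, h1, h2, -⟩ | ⟨w, s, hw, h0, h1, hcert, -⟩
    · exact absurd ⟨s, h0, h1, h2⟩ hq
    · rcases h.qc_or_vc_of_recvCert hv hw hcert with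
        ⟨u, m, hu, -, hm, -, rfl⟩ | ⟨hvw, r, m, m', hr, hsent, rfl, hcl⟩
      · have := h.network.sent_lt_recv m
        exact ((ih m (by linarith)).2 m u le_rfl hm hu).mono (by linarith)
      · have := h.network.sent_lt_recv m
        refine ((ih m' (by linarith)).1 r hr (h.network.sent_nonneg m') ?_).mono (by linarith)
        rw [hcl, clockTime_le_clockTime hΓ]
        omega
  refine ⟨key, fun m u hm hu hvu => ?_⟩
  by_cases hlt : u < v + k
  · obtain ⟨m', h1, h2⟩ := h.exists_qc_of_le hx hv le_rfl (u - v) (by omega) (m := m)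
      (by rwa [Nat.add_sub_cancel' hvu])
    obtain ⟨S, hS, hs⟩ := h.exists_quorum_of_qc h1
    refine ⟨S, hS, fun q hq => ⟨(hs q hq).1, ?_⟩⟩
    obtain ⟨hq1, s, h3, h4, h5⟩ := hs q hq
    rcases ((h.view_spec hx hq1 h3).1 _ h5).2 with ⟨-, h6⟩ | ⟨h6, -⟩
    · exact h6.mono (by linarith)
    · exact absurd hv h6
  · obtain ⟨q, s, h1, h2, h3, h4⟩ := h.exists_view_of_qc hu
    have h5 := h.clockTime_le_clock_of_view hx h1 h2 h4
    have h6 := h.clock_mono h1 h2 (τ := τ) (by linarith)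
    refine key q h1 (by linarith) (le_trans ?_ (h5.trans h6))
    rw [clockTime_le_clockTime hΓ]
    omega

/-- When a correct clock is `Γ` past the clock-time of an initial view, `t + 1` correct processors
have entered that view. -/
theorem quorumReaches_of_clock (h : E.IsFeverExecution k x B Δ δ) (hx : 2 ≤ x) (hk : 1 ≤ k)
    {v : ℕ} (hv : Initial k v) (hp : E.Correct p) (hτ : 0 ≤ τ)
    (hc : clockTime (x * Δ) (v + 1) ≤ E.clock p τ) : E.QuorumReaches (x * Δ) v τ :=
  (h.quorumReaches_aux hx hk hv τ).1 p hp hτ hc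

theorem quorumReaches_of_qc (h : E.IsFeverExecution k x B Δ δ) (hx : 2 ≤ x) (hk : 1 ≤ k)
    {v u : ℕ} (hv : Initial k v) {m : E.Msg} (hm : E.sent m ≤ τ) (hu : E.CarriesQC m u)
    (hvu : v ≤ u) : E.QuorumReaches (x * Δ) v τ :=
  (h.quorumReaches_aux hx hk hv τ).2 m u hm hu hvu

/-- A jump over `c_v` rests on a QC for a view `≥ v` or a VC for a later block, and each presupposes
`t + 1` entries into `v`. -/
theorem reaches_or_quorumReaches (h : E.IsFeverExecution k x B Δ δ) (hx : 2 ≤ x) (hk : 1 ≤ k)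
    {v : ℕ} (hv : Initial k v) (hp : E.Correct p) (hτ : 0 ≤ τ)
    (hc : clockTime (x * Δ) v ≤ E.clock p τ) :
    E.Reaches (x * Δ) p v τ ∨ E.QuorumReaches (x * Δ) v τ := by
  rcases h.reaches_or_recvCert hp hτ hx hc with
    ⟨s, h0, h1, h2, -⟩ | ⟨w, s, hw, h0, h1, hcert, -⟩
  · exact Or.inl ⟨s, h0, h1, h2⟩
  right
  rcases h.qc_or_vc_of_recvCert hv hw hcert with
    ⟨u, m, hu, -, hm, -, rfl⟩ | ⟨hvw, r, m, m', hr, hsent, rfl, hcl⟩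
  · have := h.network.sent_lt_recv m
    exact h.quorumReaches_of_qc hx hk hv (by linarith) hm hu
  · have := h.network.sent_lt_recv m
    refine (h.quorumReaches_of_clock hx hk hv hr (h.network.sent_nonneg m') ?_).mono
      (by linarith : E.sent m' ≤ τ)
    rw [hcl, clockTime_le_clockTime (h.gamma_pos hx)]
    omega

/-- The clocks of correct processors that have entered an initial view, while there is no QC for
it or for later views, can be traced back to an entry at its clock-time. -/
theorem exists_reaches_of_no_qc (h : E.IsFeverExecution k x B Δ δ) (hx : 2 ≤ x) {v : ℕ}
    (hv : Initial k v) (hp : E.Correct p) (hτ : 0 ≤ τ)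
    (hc : clockTime (x * Δ) v ≤ E.clock p τ)
    (hno : ∀ m u, E.sent m < τ → v ≤ u → ¬ E.CarriesQC m u) :
    ∃ q s, E.Correct q ∧ 0 ≤ s ∧ s ≤ τ ∧ E.clock q s = clockTime (x * Δ) v ∧
      E.clock p τ ≤ clockTime (x * Δ) v + (τ - s) := by
  have hΓ := h.gamma_pos hx
  refine h.network.message_induction (P := fun τ => ∀ p, E.Correct p → 0 ≤ τ →
    clockTime (x * Δ) v ≤ E.clock p τ →
    (∀ m u, E.sent m < τ → v ≤ u → ¬ E.CarriesQC m u) →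
    ∃ q s, E.Correct q ∧ 0 ≤ s ∧ s ≤ τ ∧ E.clock q s = clockTime (x * Δ) v ∧
      E.clock p τ ≤ clockTime (x * Δ) v + (τ - s)) ?_ τ p hp hτ hc hno
  clear! p τ
  intro τ ih p hp hτ hc hno
  rcases h.reaches_or_recvCert hp hτ hx hc with
    ⟨s, h0, h1, h2, h3⟩ | ⟨w, s, hw, h0, h1, hcert, he⟩
  · exact ⟨p, s, hp, h0, h1, h2, h3.le⟩
  · rcases h.qc_or_vc_of_recvCert hv hw hcert with
      ⟨u, m, hu, -, hm, -, rfl⟩ | ⟨hvw, r, m, m', hr, hsent, rfl, hcl⟩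
    · have := h.network.sent_lt_recv m
      exact absurd hm (hno m u (by linarith) hu)
    · have := h.network.sent_lt_recv m
      obtain ⟨q, s, h3, h4, h5, h6, h7⟩ := ih m' (by linarith) r hr (h.network.sent_nonneg m')
        (by rw [hcl, clockTime_le_clockTime hΓ]; omega)
        (fun m'' u hm'' => hno m'' u (by linarith))
      exact ⟨q, s, h3, h4, by linarith, h6, by linarith⟩

/-- A correct leader that hears of `t + 1` entries into its initial view sends out a VC in time. -/
theorem exists_vc (h : E.IsFeverExecution k x B Δ δ) {v : ℕ} (hv : Initial k v)
    (hl : E.Correct (lead n k v)) (hq : E.QuorumReaches (x * Δ) v τ) :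
    ∃ σ ≤ max E.gst τ + δ,
      IsLeast {s : ℝ | resilience n + 1 ≤ (E.viewSenders (lead n k v) v s).ncard} σ := by
  obtain ⟨S, hS, hs⟩ := hq
  set ρ := max E.gst τ + δ with hρ
  set A := {s : ℝ | resilience n + 1 ≤ (E.viewSenders (lead n k v) v s).ncard} with hA
  have hρA : ρ ∈ A := by
    refine hS.trans ?_
    rw [← Set.ncard_coe_finset]
    refine Set.ncard_le_ncard (fun q hq => ?_) (Set.toFinite _)
    obtain ⟨hq, s, h0, h1, h2⟩ := hs q hq
    obtain ⟨m, h3, h4, h5, rfl⟩ := (h.fever.view_message q hq (lead n k v) v s).2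
      ⟨h0, hv, rfl, h2⟩
    refine ⟨m, h3, h4, h5, (h.network.delay m (h3 ▸ hq) (h4 ▸ hl)).trans ?_⟩
    rw [hρ]
    gcongr
  -- The set of senders changes only at arrivals, so the least element can be sought among finitely
  -- many arrival times.
  have hdown : ∀ s ∈ A, ∃ r ∈ E.recv '' {m | E.recv m ≤ s}, r ∈ A := by
    intro s hsA
    have hfin := (h.network.finite_recv s).image E.recv
    rcases (E.recv '' {m | E.recv m ≤ s}).eq_empty_or_nonempty with he | hne
    · have : E.viewSenders (lead n k v) v s = ∅ := by
        refine Set.eq_empty_of_forall_notMem ?_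
        rintro q ⟨m, -, -, -, hm⟩
        exact he.subset ⟨m, hm, rfl⟩
      rw [hA, Set.mem_ofPred_eq, this, Set.ncard_empty] at hsA
      omega
    · obtain ⟨r, hr, hmax⟩ := Set.exists_max_image _ id hfin hne
      refine ⟨r, hr, hsA.trans (Set.ncard_le_ncard ?_ (Set.toFinite _))⟩
      rintro q ⟨m, h1, h2, h3, h4⟩
      exact ⟨m, h1, h2, h3, hmax _ ⟨m, h4, rfl⟩⟩
  have hfin : (A ∩ E.recv '' {m | E.recv m ≤ ρ}).Finite :=
    ((h.network.finite_recv ρ).image E.recv).subset Set.inter_subset_right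
  obtain ⟨r, hr, hrA⟩ := hdown ρ hρA
  obtain ⟨σ, ⟨hσA, m, hm, rfl⟩, hmin⟩ := Set.exists_min_image _ id hfin ⟨r, hrA, hr⟩
  refine ⟨E.recv m, hm, hσA, fun s hsA => ?_⟩
  obtain ⟨-, ⟨m', hm', rfl⟩, hm'A⟩ := hdown s hsA
  rcases le_total (E.recv m') ρ with h1 | h1
  · exact (hmin _ ⟨hm'A, m', h1, rfl⟩).trans hm'
  · exact (le_trans hm h1).trans hm'

/-- After GST, an initial view with correct leader is reached by all within `2 δ` after `t + 1`
correct processors have entered it. -/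
theorem clockTime_le_of_quorumReaches (h : E.IsFeverExecution k x B Δ δ) {v : ℕ}
    (hv : Initial k v) (hl : E.Correct (lead n k v)) (hq : E.QuorumReaches (x * Δ) v τ)
    (hp : E.Correct p) {σ : ℝ} (hσ : max E.gst τ + 2 * δ ≤ σ) :
    clockTime (x * Δ) v ≤ E.clock p σ := by
  obtain ⟨r, hr, hleast⟩ := h.exists_vc hv hl hq
  obtain ⟨m, h1, h2, h3, rfl⟩ := (h.fever.vc_message _ hl p v r).2 ⟨hv, rfl, hleast⟩
  have h4 := h.network.delay m (h1 ▸ hl) (h2 ▸ hp)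
  have h5 : max E.gst (E.sent m) ≤ max E.gst τ + δ :=
    max_le ((le_max_left E.gst τ).trans (by linarith [h.delta_pos])) hr
  exact h.clockTime_le_clock_of_recvCert hp (Or.inl ⟨m, h2, rfl, h3⟩) (by linarith)

end IsFeverExecution

end Execution

end Fever

/-! ### Progress under a correct leader, and synchronisation. -/

namespace Fever

theorem lead_eq_of_initial {n k v w : ℕ} [NeZero n] (hv : Initial k v) (h1 : v ≤ w)
    (h2 : w < v + k) : lead n k w = lead n k v := by
  obtain ⟨a, rfl⟩ := Nat.dvd_of_mod_eq_zero hv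
  have hk : 0 < k := by omega
  rw [lead, lead, Nat.mul_div_cancel_left a hk]
  congr 1
  refine Nat.div_eq_of_lt_le ?_ ?_
  · rw [Nat.mul_comm]; exact h1
  · rw [Nat.mul_comm, Nat.mul_add, Nat.mul_one]; exact h2

namespace Execution

variable {n : ℕ} {E : Execution n} [NeZero n] {k B : ℕ} {x Δ δ : ℝ}

theorem firstQC_le {v : ℕ} {r : ℝ} (hr : E.gst < r) (hl : E.Correct (lead n k v))
    (hp : E.Produces k v r) : E.firstQC k ≤ r :=
  sInf_le ⟨r, v, rfl, hr, hl, hp⟩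

namespace IsFeverExecution

variable {p : Fin n} {τ : ℝ}

/-- A clock that jumped over `c_v` was set to some later `c_w`: for initial `w` it then shows `c_w`
exactly, otherwise the QC for `w - 1` gives a view at least `w`. -/
theorem le_view_of_clockTime_le (h : E.IsFeverExecution k x B Δ δ) (hx : 2 ≤ x)
    {v : ℕ} (hv : Initial k v) (hp : E.Correct p) (hτ : 0 ≤ τ)
    (hc : clockTime (x * Δ) v ≤ E.clock p τ) : (v : WithBot ℕ) ≤ E.view p τ := by
  rcases h.reaches_or_recvCert hp hτ hx hc with
    ⟨s, h0, h1, h2, -⟩ | ⟨w, s, hw, h0, h1, hcert, he⟩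
  · exact (h.view_spec hx hp hτ).2.1 v hv ⟨s, h0, h1, h2⟩
  have hvw : (v : WithBot ℕ) ≤ (w : WithBot ℕ) := by exact_mod_cast hw.le
  by_cases hwi : Initial k w
  · refine hvw.trans ((h.view_spec hx hp hτ).2.1 w hwi ⟨s, h0, h1, ?_⟩)
    have h3 := h.clock_add_le hp h0 h1
    have h4 := h.clockTime_le_clock_of_recvCert hp hcert le_rfl
    linarith
  · rcases hcert with ⟨m, -, -, hm⟩ | ⟨u, rfl, hq⟩
    · exact absurd (h.exists_reaches_of_vc hm).1 hwi
    · exact hvw.trans ((h.view_spec hx hp hτ).2.2 u s hwi h1 hq)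

theorem exists_qc_of_view (h : E.IsFeverExecution k x B Δ δ) (hx : 2 ≤ x) {v w w' : ℕ}
    (hv : Initial k v) (hvw : v ≤ w) (hww : w < w') (hw' : w' < v + k)
    (hp : E.Correct p) (hτ : 0 ≤ τ) (hview : E.view p τ = (w' : WithBot ℕ)) :
    ∃ m, E.CarriesQC m w ∧ E.sent m < τ := by
  rcases ((h.view_spec hx hp hτ).1 _ hview).2 with ⟨h5, -⟩ | ⟨-, u, r, rfl, h6, m, -, rfl, h8⟩
  · exact absurd h5 (not_initial_of_lt hv (by omega) hw')
  · obtain ⟨m', h1, h2⟩ := h.exists_qc_of_le hx hv hvw (u - w) (by omega) (m := m)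
      (by rwa [Nat.add_sub_cancel' (by omega)])
    have := h.network.sent_lt_recv m
    exact ⟨m', h1, by linarith⟩

/-- If, from some time after GST on, `n - t` correct processors are kept in the block of an initial
view with correct leader, in or past the view `w`, then a QC for `w` is produced within `x δ`. -/
theorem exists_qc_of_synchronised (h : E.IsFeverExecution k x B Δ δ) (hx : 2 ≤ x) {v w : ℕ}
    (hv : Initial k v) (hvw : v ≤ w) (hw : w < v + k) (hl : E.Correct (lead n k v)) {a : ℝ}
    (ha : E.gst ≤ a) {S : Finset (Fin n)} (hS : n - resilience n ≤ S.card)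
    (hclock : ∀ p ∈ S, E.Correct p ∧ ∀ s, a ≤ s → s < a + x * δ →
      clockTime (x * Δ) v ≤ E.clock p s ∧ E.clock p s < clockTime (x * Δ) (v + k))
    (hprev : v < w → ∀ p ∈ S, E.HasQC p (w - 1) a) :
    ∃ m, E.CarriesQC m w ∧ E.sent m < a + x * δ := by
  -- Being past `w` in the block needs a QC for `w`. Without one, all of `S` stay exactly in view
  -- `w`, and the underlying protocol produces the QC.
  by_contra! hno
  have hΓ := h.gamma_pos hx
  have hview : ∀ p ∈ S, E.Correct p ∧ E.InViewUntilQC p w a (a + x * δ) := by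
    refine fun p hp => ⟨(hclock p hp).1, fun s hs hs' => Or.inl ?_⟩
    obtain ⟨hpc, hcl⟩ := hclock p hp
    have hs0 : 0 ≤ s := h.network.gst_nonneg.trans (ha.trans hs)
    have hle : (w : WithBot ℕ) ≤ E.view p s := by
      rcases hvw.eq_or_lt with rfl | hlt
      · exact h.le_view_of_clockTime_le hx hv hpc hs0 (hcl s hs hs').1
      · obtain ⟨r, hr, hq⟩ := hprev hlt p hp
        have hw1 : w - 1 + 1 = w := by omega
        have := (h.view_spec hx hpc hs0).2.2 (w - 1) r
          (by rw [hw1]; exact not_initial_of_lt hv hlt hw) (hr.trans hs) hq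
        rwa [hw1] at this
    cases hvp : E.view p s with
    | bot => rw [hvp] at hle; exact absurd (le_bot_iff.1 hle) WithBot.coe_ne_bot
    | coe w' =>
      rw [hvp] at hle
      have hle' : w ≤ w' := WithBot.coe_le_coe.1 hle
      rcases hle'.eq_or_lt with rfl | hlt
      · rfl
      have h1 := (h.clockTime_le_clock_of_view hx hpc hs0 hvp).trans_lt (hcl s hs hs').2
      have h2 : w' < v + k := by
        rw [← not_le, ← clockTime_le_clockTime hΓ, not_le]; exact h1
      obtain ⟨m, hm, hms⟩ := h.exists_qc_of_view hx hv hvw hlt h2 hpc hs0 hvp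
      exact absurd (hno m hm) (by linarith)
  have hlw : E.Correct (lead n k w) := by rwa [lead_eq_of_initial hv hvw hw]
  obtain ⟨q, hq⟩ := h.exists_correct
  obtain ⟨s, hs, m, -, rfl, hm⟩ :=
    h.underlying.sufficient_time w a hlw ha ⟨S, hS, hview⟩ q hq
  have := h.network.sent_lt_recv m
  exact absurd (hno m hm) (by linarith)

theorem card_correct (h : E.IsFeverExecution k x B Δ δ) :
    n - resilience n ≤ (Finset.univ \ E.byz).card := by
  have h1 := Finset.le_card_sdiff E.byz Finset.univ
  rw [Finset.card_univ, Fintype.card_fin] at h1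
  have := h.byz_card
  omega

/-- A race between the QC and the end of the block, run by contradiction. As before, the claims on
clocks and on later QCs are proved together, so that a missing QC for `v` excludes earlier QCs for
all later views. -/
theorem exists_qc_aux (h : E.IsFeverExecution k x B Δ δ) (hx : 2 ≤ x) (hk : 3 ≤ k) {v : ℕ}
    (hv : Initial k v) (hl : E.Correct (lead n k v))
    (hgst : ∀ p, E.Correct p → E.clock p E.gst < clockTime (x * Δ) v) (τ : ℝ) :
    (∀ p, E.Correct p → 0 ≤ τ → clockTime (x * Δ) (v + k) ≤ E.clock p τ →
      ∃ m, E.CarriesQC m v ∧ E.sent m ≤ τ) ∧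
    (∀ m u, E.sent m ≤ τ → E.CarriesQC m u → v ≤ u → ∃ m', E.CarriesQC m' v ∧ E.sent m' ≤ τ) := by
  have hΓ := h.gamma_pos hx
  refine h.network.message_induction (P := fun τ =>
    (∀ p, E.Correct p → 0 ≤ τ → clockTime (x * Δ) (v + k) ≤ E.clock p τ →
      ∃ m, E.CarriesQC m v ∧ E.sent m ≤ τ) ∧
    (∀ m u, E.sent m ≤ τ → E.CarriesQC m u → v ≤ u →
      ∃ m', E.CarriesQC m' v ∧ E.sent m' ≤ τ)) ?_ τ
  clear τ
  intro τ ih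
  have key : ∀ p, E.Correct p → 0 ≤ τ → clockTime (x * Δ) (v + k) ≤ E.clock p τ →
      ∃ m, E.CarriesQC m v ∧ E.sent m ≤ τ := by
    intro p hp hτ hc
    by_contra! hno
    have hno' : ∀ m u, E.sent m < τ → v ≤ u → ¬ E.CarriesQC m u := by
      intro m u hm hvu hq
      obtain ⟨m', h1, h2⟩ := (ih m hm).2 m u le_rfl hq hvu
      exact absurd (hno m' h1) (by linarith)
    have horigin : ∀ q, E.Correct q → ∀ s, 0 ≤ s → s ≤ τ → clockTime (x * Δ) v ≤ E.clock q s →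
        ∃ q' s', E.Correct q' ∧ 0 ≤ s' ∧ s' ≤ s ∧ E.clock q' s' = clockTime (x * Δ) v ∧
          E.clock q s ≤ clockTime (x * Δ) v + (s - s') := fun q hq s hs hsτ hcs =>
      h.exists_reaches_of_no_qc hx hv hq hs hcs fun m u hm => hno' m u (by linarith)
    have hfin : {s | ∃ q, E.Correct q ∧ 0 ≤ s ∧ s ≤ τ ∧
        E.clock q s = clockTime (x * Δ) v}.Finite := by
      have : (⋃ q ∈ {q | E.Correct q},
          {s | 0 ≤ s ∧ E.clock q s = clockTime (x * Δ) v}).Finite :=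
        Set.Finite.biUnion (Set.toFinite _) fun q hq =>
          Set.Subsingleton.finite fun s hs r hr =>
            h.eq_of_clock_eq hq hs.1 hr.1 (hs.2.trans hr.2.symm)
      refine this.subset ?_
      rintro s ⟨q, hq, h0, -, hs⟩
      simp only [Set.mem_iUnion]
      exact ⟨q, hq, h0, hs⟩
    have hvk : clockTime (x * Δ) v ≤ clockTime (x * Δ) (v + k) :=
      (clockTime_le_clockTime hΓ).2 (Nat.le_add_right v k)
    obtain ⟨q₁, s₁, h1, h2, h3, h4, -⟩ := horigin p hp τ hτ le_rfl (hvk.trans hc)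
    -- With `s₀` the first entry into `v`, no clock past `c_v` exceeds `c_v` by more than the time
    -- since `s₀`.
    obtain ⟨s₀, ⟨q₀, hq₀, hs₀, hs₀τ, hc₀⟩, hmin⟩ :=
      Set.exists_min_image _ id hfin ⟨s₁, q₁, h1, h2, h3, h4⟩
    have hbound : ∀ q, E.Correct q → ∀ s, 0 ≤ s → s ≤ τ → clockTime (x * Δ) v ≤ E.clock q s →
        E.clock q s ≤ clockTime (x * Δ) v + (s - s₀) := by
      intro q hq s hs hsτ hcs
      obtain ⟨q', s', h5, h6, h7, h8, h9⟩ := horigin q hq s hs hsτ hcs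
      have : s₀ ≤ s' := hmin s' ⟨q', h5, h6, h7.trans hsτ, h8⟩
      linarith
    have hgs : E.gst < s₀ := by
      by_contra! hle
      have h5 := h.clock_mono hq₀ hs₀ hle
      have h6 := hgst q₀ hq₀
      linarith
    have hk' : (3 : ℝ) ≤ k := by exact_mod_cast hk
    have hlong : s₀ + 3 * (x * Δ) ≤ τ := by
      have h5 := hbound p hp τ hτ le_rfl (hvk.trans hc)
      rw [clockTime_add] at hc
      nlinarith
    have hδ : x * δ ≤ x * Δ := mul_le_mul_of_nonneg_left h.delta_le (by linarith)
    have hδ2 : 2 * δ ≤ x * δ := mul_le_mul_of_nonneg_right hx h.delta_pos.le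
    have hδ0 := h.delta_pos
    have hquorum : E.QuorumReaches (x * Δ) v (s₀ + x * Δ) := by
      refine h.quorumReaches_of_clock hx (by omega) hv hq₀ (by linarith) ?_
      have := h.clock_add_le hq₀ hs₀ (τ := s₀ + x * Δ) (by linarith)
      rw [clockTime_add]
      push_cast
      linarith
    -- Γ for a quorum to enter, 2δ ≤ Γ for the VC to reach all, and xδ ≤ Γ for the QC: within the 3Γ
    -- that are available by `hlong`.
    obtain ⟨m, hm, hms⟩ := h.exists_qc_of_synchronised hx hv le_rfl (by omega) hl
      (a := s₀ + x * Δ + 2 * δ) (by linarith) h.card_correct (fun q hq => by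
        have hqc : E.Correct q := (Finset.mem_sdiff.1 hq).2
        refine ⟨hqc, fun s hs hs' => ?_⟩
        have h5 := h.clockTime_le_of_quorumReaches hv hl hquorum hqc (σ := s)
          (by rw [max_eq_right (by linarith)]; exact hs)
        refine ⟨h5, (hbound q hqc s (by linarith) (by linarith) h5).trans_lt ?_⟩
        rw [clockTime_add]
        nlinarith) (fun hlt => absurd hlt (lt_irrefl v))
    exact absurd (hno m hm) (by linarith)
  refine ⟨key, fun m u hm hu hvu => ?_⟩
  by_cases hlt : u < v + k
  · obtain ⟨m', h1, h2⟩ := h.exists_qc_of_le hx hv le_rfl (u - v) (by omega) (m := m)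
      (by rwa [Nat.add_sub_cancel' hvu])
    exact ⟨m', h1, h2.trans hm⟩
  · obtain ⟨q, s, h1, h2, h3, h4⟩ := h.exists_view_of_qc hu
    have h5 := h.clockTime_le_clock_of_view hx h1 h2 h4
    have h6 := h.clock_mono h1 h2 (τ := τ) (by linarith)
    refine key q h1 (by linarith) (le_trans ?_ (h5.trans h6))
    rw [clockTime_le_clockTime hΓ]
    omega

theorem exists_produces (h : E.IsFeverExecution k x B Δ δ) {v : ℕ} (hl : E.Correct (lead n k v))
    {m : E.Msg} (hm : E.CarriesQC m v) : ∃ r ≤ E.sent m, E.Produces k v r := by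
  obtain ⟨m', h1, h2, h3⟩ := h.underlying.qc_leader m v hl hm
  have hfin : {m | E.src m = lead n k v ∧ E.CarriesQC m v ∧ E.sent m ≤ E.sent m'}.Finite :=
    (h.network.finite_sent _).subset fun m hm => hm.2.2
  obtain ⟨m₀, ⟨h4, h5, h6⟩, hmin⟩ := Set.exists_min_image _ E.sent hfin ⟨m', h1, h2, le_rfl⟩
  refine ⟨E.sent m₀, h6.trans h3, ⟨m₀, h4, h5, rfl⟩, ?_⟩
  rintro s ⟨m₁, h7, h8, rfl⟩
  rcases le_total (E.sent m₁) (E.sent m') with h9 | h9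
  · exact hmin m₁ ⟨h7, h8, h9⟩
  · exact h6.trans h9

theorem hasQC_of_produces (h : E.IsFeverExecution k x B Δ δ) {v : ℕ}
    (hl : E.Correct (lead n k v)) {r : ℝ} (hr : E.Produces k v r) (hp : E.Correct p)
    (hτ : max E.gst r + δ ≤ τ) : E.HasQC p v τ := by
  obtain ⟨m, h1, h2, h3, rfl⟩ := h.underlying.qc_broadcast v r hl hr p
  exact ⟨E.recv m, (h.network.delay m (h1 ▸ hl) (h2 ▸ hp)).trans hτ, m, h2, rfl, h3⟩

theorem gst_lt_of_qc (h : E.IsFeverExecution k x B Δ δ) (hx : 2 ≤ x) {v : ℕ}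
    (hgst : ∀ p, E.Correct p → E.clock p E.gst < clockTime (x * Δ) v) {m : E.Msg}
    (hm : E.CarriesQC m v) : E.gst < E.sent m := by
  by_contra! hle
  obtain ⟨q, s, h1, h2, h3, h4⟩ := h.exists_view_of_qc hm
  have h5 := h.clockTime_le_clock_of_view hx h1 h2 h4
  have h6 := h.clock_mono h1 h2 (h3.trans hle)
  have h7 := hgst q h1
  linarith

/-- Progress: the first initial view with correct leader that lies past all correct clocks at GST
ends with a QC before any correct processor leaves its block. -/
theorem exists_produces_of_clock (h : E.IsFeverExecution k x B Δ δ) (hx : 2 ≤ x) (hk : 3 ≤ k)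
    {v : ℕ} (hv : Initial k v) (hl : E.Correct (lead n k v))
    (hgst : ∀ p, E.Correct p → E.clock p E.gst < clockTime (x * Δ) v)
    (hp : E.Correct p) (hτ : 0 ≤ τ) (hc : clockTime (x * Δ) (v + k) ≤ E.clock p τ) :
    ∃ r, E.gst < r ∧ r ≤ τ ∧ E.Produces k v r := by
  obtain ⟨m, hm, hmτ⟩ := (h.exists_qc_aux hx hk hv hl hgst τ).1 p hp hτ hc
  obtain ⟨r, hr, hprod⟩ := h.exists_produces hl hm
  refine ⟨r, ?_, hr.trans hmτ, hprod⟩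
  obtain ⟨m', -, h1, rfl⟩ := hprod.1
  exact h.gst_lt_of_qc hx hgst h1

/-- The leaders of `f + 1 ≤ n` consecutive blocks are distinct, so they cannot all be Byzantine. -/
theorem exists_correct_lead (h : E.IsFeverExecution k x B Δ δ) (hk : 1 ≤ k) (a : ℕ) :
    ∃ j, a ≤ j ∧ j ≤ a + E.byz.card ∧ E.Correct (lead n k (k * j)) := by
  by_contra! hno
  have hlead : ∀ j, lead n k (k * j) = Fin.ofNat n j := fun j => by
    rw [lead, Nat.mul_div_cancel_left j hk]
  have hf : E.byz.card < n := by
    have := h.byz_card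
    have := three_mul_resilience_lt n
    omega
  have hinj : Set.InjOn (fun i => Fin.ofNat n (a + i)) (Finset.range (E.byz.card + 1)) := by
    intro i hi j hj hij
    simp only [Finset.coe_range, Set.mem_Iio] at hi hj
    have h1 : (a + i) ≡ (a + j) [MOD n] := congrArg Fin.val hij
    have h2 : i ≡ j [MOD n] := Nat.ModEq.add_left_cancel' a h1
    exact Nat.ModEq.eq_of_lt_of_lt h2 (by omega) (by omega)
  have h1 : (Finset.range (E.byz.card + 1)).image (fun i => Fin.ofNat n (a + i)) ⊆ E.byz := by
    intro q hq
    obtain ⟨i, hi, rfl⟩ := Finset.mem_image.1 hq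
    rw [Finset.mem_range] at hi
    have := hno (a + i) (by omega) (by omega)
    rw [hlead] at this
    exact not_not.1 this
  have h2 := Finset.card_le_card h1
  rw [Finset.card_image_of_injOn hinj, Finset.card_range] at h2
  omega

theorem exists_clock_lt (h : E.IsFeverExecution k x B Δ δ) (hx : 2 ≤ x) (hk : 1 ≤ k) (τ : ℝ) :
    ∃ j, ∀ p, E.Correct p → E.clock p τ < clockTime (x * Δ) (k * j) := by
  have hΓ := h.gamma_pos hx
  obtain ⟨C, hC⟩ := (Set.finite_range fun p => E.clock p τ).bddAbove
  obtain ⟨N, hN⟩ := exists_nat_gt (C / (x * Δ))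
  rw [div_lt_iff₀ hΓ] at hN
  refine ⟨N, fun p _ => ?_⟩
  have h1 : E.clock p τ ≤ C := hC ⟨p, rfl⟩
  have h2 : clockTime (x * Δ) N ≤ clockTime (x * Δ) (k * N) :=
    (clockTime_le_clockTime hΓ).2 (Nat.le_mul_of_pos_left N hk)
  rw [clockTime] at h2
  linarith

/-- The leader of a view that is new after GST produces a QC, and its broadcast completes the view
for everyone. Messages can be reordered, so that a processor may be ahead of the view before the
QC arrives; the time is therefore taken to be the end of the broadcast. -/
theorem eventuallySynchronised (h : E.IsFeverExecution k x B Δ δ) (hx : 2 ≤ x) (hk : 3 ≤ k) :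
    E.EventuallySynchronised k (x * Δ) := by
  have hΓ := h.gamma_pos hx
  obtain ⟨a, ha⟩ := h.exists_clock_lt hx (by omega) E.gst
  obtain ⟨j, haj, -, hl⟩ := h.exists_correct_lead (by omega) a
  have hgst : ∀ p, E.Correct p → E.clock p E.gst < clockTime (x * Δ) (k * j) := fun p hp =>
    (ha p hp).trans_le ((clockTime_le_clockTime hΓ).2 (Nat.mul_le_mul_left k haj))
  obtain ⟨q, hq⟩ := h.exists_correct
  -- At speed at least one, the clock of `q` is past the block by this time.
  set τ := clockTime (x * Δ) (k * j + k) - E.clock q 0 with hτ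
  have hτ0 : 0 ≤ τ := by
    have := clockTime_nonneg hΓ (k * j + k)
    have := h.clocks.clock_zero_nonpos q hq
    linarith
  have hc := h.clock_add_le hq le_rfl hτ0
  obtain ⟨r, hr, -, hprod⟩ := h.exists_produces_of_clock hx hk (initial_mul k j) hl hgst hq hτ0
    (by linarith)
  refine ⟨k * j, r + δ, hl, by linarith [h.delta_pos], fun p hp => ?_, fun p hp s hs _ => ?_⟩
  · cases hview : E.view p E.gst with
    | bot => exact WithBot.bot_lt_coe _
    | coe w =>
      have h1 := h.clockTime_le_clock_of_view hx hp h.network.gst_nonneg hview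
      have h2 := h1.trans_lt (hgst p hp)
      rw [← not_le, clockTime_le_clockTime hΓ, not_le] at h2
      exact WithBot.coe_lt_coe.2 h2
  · exact Or.inr (h.hasQC_of_produces hl hprod hp (by rwa [max_eq_right hr.le]))

end IsFeverExecution

end Execution

end Fever

/-! ### Word complexity and latency. -/

namespace Fever

theorem encard_biUnion_le_card_mul {ι α : Type*} (s : Finset ι) (f : ι → Set α) (c : ℕ∞)
    (hf : ∀ i ∈ s, (f i).encard ≤ c) : (⋃ i ∈ s, f i).encard ≤ s.card * c := by
  rw [← nsmul_eq_mul]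
  exact (s.set_encard_biUnion_le f).trans (Finset.sum_le_card_nsmul s _ c hf)

theorem encard_le_of_injOn_fin {α : Type*} {n : ℕ} {s : Set α} {f : α → Fin n}
    (hf : Set.InjOn f s) : s.encard ≤ n := by
  rw [← hf.encard_image]
  refine (Set.encard_le_encard (Set.subset_univ _)).trans ?_
  simp

namespace Execution

variable {n : ℕ} {E : Execution n} [NeZero n] {k B : ℕ} {x Δ δ : ℝ}

theorem latency_le {r : ℝ} (hr : E.firstQC k ≤ r) : E.latency k ≤ ((r - E.gst : ℝ) : EReal) := by
  rw [EReal.coe_sub]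
  exact EReal.sub_le_sub hr le_rfl

namespace IsFeverExecution

variable {p : Fin n} {τ : ℝ}

theorem encard_view_le (h : E.IsFeverExecution k x B Δ δ) (v : ℕ) :
    {m | E.Correct (E.src m) ∧ E.content m = Content.view v}.encard ≤ n := by
  refine encard_le_of_injOn_fin (f := E.src) fun m hm m' hm' heq => ?_
  obtain ⟨h1, h2, h3, h4⟩ := (h.fever.view_message _ hm.1 (E.dst m) v (E.sent m)).1
    ⟨m, rfl, rfl, hm.2, rfl⟩
  obtain ⟨h5, h6, h7, h8⟩ := (h.fever.view_message _ hm'.1 (E.dst m') v (E.sent m')).1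
    ⟨m', rfl, rfl, hm'.2, rfl⟩
  refine h.fever.once m m' v hm.1 (Or.inl hm.2) heq (h3.trans h7.symm) (hm.2.trans hm'.2.symm)
    (h.eq_of_clock_eq hm.1 h1 h5 ?_)
  rw [h4, heq, h8]

/-- The sender is the leader and the time is the least element of a fixed set, so the recipient
determines the message. -/
theorem encard_vc_le (h : E.IsFeverExecution k x B Δ δ) (v : ℕ) :
    {m | E.Correct (E.src m) ∧ E.content m = Content.vc v}.encard ≤ n := by
  refine encard_le_of_injOn_fin (f := E.dst) fun m hm m' hm' heq => ?_
  obtain ⟨-, h2, h3⟩ := (h.fever.vc_message _ hm.1 (E.dst m) v (E.sent m)).1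
    ⟨m, rfl, rfl, hm.2, rfl⟩
  obtain ⟨-, h5, h6⟩ := (h.fever.vc_message _ hm'.1 (E.dst m') v (E.sent m')).1
    ⟨m', rfl, rfl, hm'.2, rfl⟩
  refine h.fever.once m m' v hm.1 (Or.inr hm.2) (h2.trans h5.symm) heq (hm.2.trans hm'.2.symm) ?_
  rw [h2] at h3
  rw [h5] at h6
  exact h3.unique h6

/-- The number of the first block that no correct processor has reached by GST. -/
theorem exists_first_block (h : E.IsFeverExecution k x B Δ δ) (hx : 2 ≤ x) (hk : 1 ≤ k) :
    ∃ b, (∀ p, E.Correct p → E.clock p E.gst < clockTime (x * Δ) (k * b)) ∧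
      (0 < b → ∃ p, E.Correct p ∧ clockTime (x * Δ) (k * (b - 1)) ≤ E.clock p E.gst) := by
  classical
  have hex := h.exists_clock_lt hx hk E.gst
  refine ⟨Nat.find hex, Nat.find_spec hex, fun hb => ?_⟩
  have := Nat.find_min hex (m := Nat.find hex - 1) (by omega)
  push Not at this
  exact this

theorem firstQC_le_of_clock (h : E.IsFeverExecution k x B Δ δ) (hx : 2 ≤ x) (hk : 3 ≤ k) {b : ℕ}
    (hb : ∀ p, E.Correct p → E.clock p E.gst < clockTime (x * Δ) (k * b))
    (hp : E.Correct p) (hτ : 0 ≤ τ)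
    (hc : clockTime (x * Δ) (k * (b + E.byz.card + 1)) ≤ E.clock p τ) : E.firstQC k ≤ τ := by
  have hΓ := h.gamma_pos hx
  obtain ⟨j, h1, h2, hl⟩ := h.exists_correct_lead (by omega) b
  obtain ⟨r, hr, hrτ, hprod⟩ := h.exists_produces_of_clock hx hk (initial_mul k j) hl
    (fun p hp => (hb p hp).trans_le ((clockTime_le_clockTime hΓ).2 (Nat.mul_le_mul_left k h1)))
    hp hτ (le_trans ((clockTime_le_clockTime hΓ).2 (by
      rw [← Nat.mul_succ]; exact Nat.mul_le_mul_left k (by omega))) hc)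
  exact (firstQC_le hr hl hprod).trans (by exact_mod_cast hrτ)

/-- Some correct clock has reached block `b - 1` by GST, so it is at least Γ past the start of every
block up to `b - 2`. -/
theorem quorumReaches_gst (h : E.IsFeverExecution k x B Δ δ) (hx : 2 ≤ x) (hk : 1 ≤ k) {b : ℕ}
    (hb : 0 < b → ∃ p, E.Correct p ∧ clockTime (x * Δ) (k * (b - 1)) ≤ E.clock p E.gst)
    {j : ℕ} (hj : j + 2 ≤ b) : E.QuorumReaches (x * Δ) (k * j) E.gst := by
  obtain ⟨p, hp, hc⟩ := hb (by omega)
  refine h.quorumReaches_of_clock hx hk (initial_mul k j) hp h.network.gst_nonneg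
    (le_trans ((clockTime_le_clockTime (h.gamma_pos hx)).2 ?_) hc)
  calc k * j + 1 ≤ k * j + k := by omega
    _ = k * (j + 1) := by ring
    _ ≤ k * (b - 1) := Nat.mul_le_mul_left k (by omega)

theorem le_view_of_gst_add_le (h : E.IsFeverExecution k x B Δ δ) (hx : 2 ≤ x) (hk : 1 ≤ k) {b : ℕ}
    (hb : 0 < b → ∃ p, E.Correct p ∧ clockTime (x * Δ) (k * (b - 1)) ≤ E.clock p E.gst)
    (hp : E.Correct p) (hτ : E.gst + 2 * δ ≤ τ) {w : ℕ} (hw : E.view p τ = (w : WithBot ℕ)) :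
    k * (b - 2 - E.byz.card) ≤ w := by
  -- Here the truncated subtraction gives 0. Otherwise one of the blocks `b - 2 - f, …, b - 2` has a
  -- correct leader, whose VC reaches everyone by GST + 2δ.
  by_cases hlt : b < 2 + E.byz.card
  · rw [show b - 2 - E.byz.card = 0 by omega]
    omega
  obtain ⟨j, h1, h2, hl⟩ := h.exists_correct_lead hk (b - 2 - E.byz.card)
  have h3 := h.quorumReaches_gst hx hk hb (j := j) (by omega)
  have h4 := h.clockTime_le_of_quorumReaches (initial_mul k j) hl h3 hp (σ := τ)
    (by rwa [max_self])
  have h5 := h.le_view_of_clockTime_le hx (initial_mul k j) hp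
    (h.network.gst_nonneg.trans (by linarith [h.delta_pos])) h4
  rw [hw] at h5
  exact (Nat.mul_le_mul_left k h1).trans (WithBot.coe_le_coe.1 h5)

/-- At most `2f + 3` blocks are involved, each with `k` views of at most `Bn` underlying messages,
`n` view messages and `n` VC messages. -/
theorem wordsFrom_le (h : E.IsFeverExecution k x B Δ δ) (hx : 2 ≤ x) (hk : 3 ≤ k) :
    E.wordsFrom k (E.gst + 2 * δ) ≤ ((3 * (k * B + 2) * (E.byz.card * n + n) : ℕ) : ℕ∞) := by
  have hΓ := h.gamma_pos hx
  obtain ⟨b, hb, hb'⟩ := h.exists_first_block hx (by omega)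
  set f := E.byz.card with hf
  set s := Finset.Ico (b - 2 - f) (b + f + 1) with hs
  set s' := Finset.Ico (k * (b - 2 - f)) (k * (b + f + 1)) with hs'
  have hsub : {m | E.Correct (E.src m) ∧ E.gst + 2 * δ < E.sent m ∧
      (E.sent m : EReal) < E.firstQC k} ⊆
      ((⋃ w ∈ s', {m | E.Correct (E.src m) ∧ ∃ q, E.content m = Content.under w q}) ∪
      ⋃ j ∈ s, {m | E.Correct (E.src m) ∧ E.content m = Content.view (k * j)}) ∪
      ⋃ j ∈ s, {m | E.Correct (E.src m) ∧ E.content m = Content.vc (k * j)} := by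
    rintro m ⟨hm, hsent, hfirst⟩
    have hupper : ∀ q, E.Correct q → ∀ σ, 0 ≤ σ → σ ≤ E.sent m → ∀ v,
        clockTime (x * Δ) v ≤ E.clock q σ → v < k * (b + f + 1) := by
      intro q hq σ h0 hσ v hv
      by_contra! hle
      have h1 := h.firstQC_le_of_clock hx hk hb hq h0
        (le_trans ((clockTime_le_clockTime hΓ).2 hle) hv)
      have h2 : (σ : EReal) ≤ E.sent m := by exact_mod_cast hσ
      exact absurd (h1.trans h2) (not_le.2 hfirst)
    have hrange : ∀ w : ℕ, E.view (E.src m) (E.sent m) = (w : WithBot ℕ) → w ∈ s' := by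
      intro w hw
      rw [hs', Finset.mem_Ico]
      exact ⟨h.le_view_of_gst_add_le hx (by omega) hb' hm hsent.le hw,
        hupper _ hm _ (h.network.sent_nonneg m) le_rfl w
          (h.clockTime_le_clock_of_view hx hm (h.network.sent_nonneg m) hw)⟩
    cases hc : E.content m with
    | view v =>
      obtain ⟨h1, h2, -, h4⟩ := (h.fever.view_message _ hm (E.dst m) v (E.sent m)).1
        ⟨m, rfl, rfl, hc, rfl⟩
      have h5 := hrange v (h.fever.view_initial _ hm v h2 _ h1 h4)
      obtain ⟨j, rfl⟩ := Nat.dvd_of_mod_eq_zero h2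
      rw [hs', Finset.mem_Ico] at h5
      refine Or.inl (Or.inr (Set.mem_biUnion (x := j) ?_ ⟨hm, hc⟩))
      rw [hs, Finset.mem_coe, Finset.mem_Ico]
      exact ⟨Nat.le_of_mul_le_mul_left h5.1 (by omega), Nat.lt_of_mul_lt_mul_left h5.2⟩
    | vc v =>
      obtain ⟨h1, h2, h3⟩ := (h.fever.vc_message _ hm (E.dst m) v (E.sent m)).1
        ⟨m, rfl, rfl, hc, rfl⟩
      obtain ⟨j, rfl⟩ := Nat.dvd_of_mod_eq_zero h1
      obtain ⟨-, q, m', h4, h5, h6⟩ := h.exists_reaches_of_vc hc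
      have h7 := hupper q h4 _ (h.network.sent_nonneg m') h5 _ h6.ge
      refine Or.inr (Set.mem_biUnion (x := j) ?_ ⟨hm, hc⟩)
      rw [hs, Finset.mem_coe, Finset.mem_Ico]
      refine ⟨?_, Nat.lt_of_mul_lt_mul_left h7⟩
      -- For a block this early `t + 1` entries happened by GST, so its correct leader sent the VC
      -- by GST + δ.
      by_contra! hlt
      rw [h2] at hm h3
      obtain ⟨σ, hσ, hleast⟩ := h.exists_vc h1 hm
        (h.quorumReaches_gst hx (by omega) hb' (j := j) (by omega))
      rw [max_self] at hσ
      have := h3.unique hleast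
      linarith [h.delta_pos]
    | under w q =>
      refine Or.inl (Or.inl (Set.mem_biUnion (x := w) ?_ ⟨hm, q, hc⟩))
      rcases h.underlying.in_view m w q hm hc with h1 | ⟨-, h2, h3⟩
      · exact hrange w h1
      -- A leader that sends outside its view is producing a QC, which cannot happen between GST and
      -- t*.
      · exact absurd (firstQC_le (by linarith [h.delta_pos]) (h2 ▸ hm) h3) (not_le.2 hfirst)
  have hcard : s.card ≤ 2 * f + 3 := by
    rw [hs, Nat.card_Ico]; omega
  have hcard' : s'.card ≤ k * (2 * f + 3) := by
    rw [hs', Nat.card_Ico, ← Nat.mul_sub]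
    exact Nat.mul_le_mul_left k (by omega)
  have h1 := encard_biUnion_le_card_mul s' _ _ fun w _ => h.underlying.linear w
  have h2 := encard_biUnion_le_card_mul s _ _ fun j _ => h.encard_view_le (k * j)
  have h3 := encard_biUnion_le_card_mul s _ _ fun j _ => h.encard_vc_le (k * j)
  refine (Set.encard_le_encard hsub).trans ((Set.encard_union_le _ _).trans
    ((add_le_add ((Set.encard_union_le _ _).trans (add_le_add h1 h2)) h3).trans ?_))
  norm_cast
  calc s'.card * (B * n) + s.card * n + s.card * n
      ≤ k * (2 * f + 3) * (B * n) + (2 * f + 3) * n + (2 * f + 3) * n := by gcongr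
    _ = (2 * f + 3) * ((k * B + 2) * n) := by ring
    _ ≤ (3 * f + 3) * ((k * B + 2) * n) := Nat.mul_le_mul_right _ (by omega)
    _ = 3 * (k * B + 2) * (f * n + n) := by ring

theorem latency_le_of_begun (h : E.IsFeverExecution k x B Δ δ) (hx : 2 ≤ x) (hk : 3 ≤ k)
    (hp : E.Correct p) (hc : 0 ≤ E.clock p E.gst) :
    E.latency k ≤ ((x * Δ * (k * (E.byz.card + 2)) : ℝ) : EReal) := by
  have hΓ := h.gamma_pos hx
  obtain ⟨b, hb, hb'⟩ := h.exists_first_block hx (by omega)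
  have hb0 : 0 < b := by
    by_contra! hle
    have := hb p hp
    rw [Nat.le_zero.1 hle, Nat.mul_zero, clockTime_zero] at this
    linarith
  obtain ⟨q, hq, hqc⟩ := hb' hb0
  -- The clock of `q` runs from block `b - 1` to block `b + f + 1`, which is `f + 2` blocks of
  -- length kΓ.
  set τ := E.gst + x * Δ * (k * (E.byz.card + 2)) with hτ
  have hτg : E.gst ≤ τ := by
    rw [hτ]
    have : 0 ≤ x * Δ * (k * ((E.byz.card : ℝ) + 2)) := by positivity
    linarith
  have h1 := h.firstQC_le_of_clock hx hk hb hq (h.network.gst_nonneg.trans hτg) (by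
    have h2 := h.clock_add_le hq h.network.gst_nonneg hτg
    obtain ⟨a, rfl⟩ := Nat.exists_eq_add_of_le' hb0
    rw [Nat.add_sub_cancel] at hqc
    rw [clockTime] at hqc ⊢
    push_cast at hqc ⊢
    linarith)
  refine (latency_le h1).trans (le_of_eq ?_)
  rw [hτ, add_sub_cancel_left]

/-- With correct leaders only, and as long as no QC is produced after GST, the next block is
entered by `t + 1` processors within `(2 + x) δ`. -/
theorem quorumReaches_succ (h : E.IsFeverExecution k x B Δ δ) (hx : 2 ≤ x) (hk : 1 ≤ k)
    (hall : ∀ p, E.Correct p) {T : ℝ}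
    (hno : ∀ v r, E.gst < r → r ≤ T → ¬ E.Produces k v r) (hτ : E.gst ≤ τ)
    (hτT : τ + (2 + x) * δ ≤ T) {j : ℕ} (hj : E.QuorumReaches (x * Δ) (k * j) τ) :
    E.QuorumReaches (x * Δ) (k * (j + 1)) (τ + (2 + x) * δ) := by
  classical
  by_contra hnq
  have hδ := h.delta_pos
  have hxδ : 0 < x * δ := mul_pos (by linarith) hδ
  have he : τ + (2 + x) * δ = τ + 2 * δ + x * δ := by ring
  rw [he] at hnq hτT
  have hg := h.network.gst_nonneg
  set a := τ + 2 * δ with ha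
  -- If fewer than `t + 1` processors enter the next block, at least `n - t` do not; they stay in
  -- block `j`, since jumping over the next entry would also presuppose a quorum there.
  set S := Finset.univ.filter fun q => ¬ E.Reaches (x * Δ) q (k * (j + 1)) (a + x * δ) with hSdef
  have hS : n - resilience n ≤ S.card := by
    have h1 := Finset.card_filter_add_card_filter_not (s := (Finset.univ : Finset (Fin n)))
      (fun q => E.Reaches (x * Δ) q (k * (j + 1)) (a + x * δ))
    rw [Finset.card_univ, Fintype.card_fin, ← hSdef] at h1
    by_contra! hlt
    exact hnq ⟨Finset.univ.filter fun q => E.Reaches (x * Δ) q (k * (j + 1)) (a + x * δ),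
      by omega, fun q hq => ⟨hall q, (Finset.mem_filter.1 hq).2⟩⟩
  have hclock : ∀ p ∈ S, E.Correct p ∧ ∀ s, a ≤ s → s < a + x * δ →
      clockTime (x * Δ) (k * j) ≤ E.clock p s ∧
        E.clock p s < clockTime (x * Δ) (k * j + k) := by
    refine fun p hp => ⟨hall p, fun s hs hs' => ⟨h.clockTime_le_of_quorumReaches
      (initial_mul k j) (hall _) hj (hall p) (by rwa [max_eq_right hτ]), ?_⟩⟩
    by_contra! hle
    rw [← Nat.mul_succ] at hle
    rcases h.reaches_or_quorumReaches hx hk (initial_mul k (j + 1)) (hall p) (by linarith) hle with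
      h1 | h1
    · exact (Finset.mem_filter.1 hp).2 (h1.mono hs'.le)
    · exact hnq (h1.mono hs'.le)
  -- Every QC seen so far was produced by GST, hence is held by all at `a`. So the one window from
  -- `a` to `a + xδ` serves all `k` views of the block, and the last QC was already known at `a` and
  -- moves the clocks out of it.
  have hknown : ∀ m u, E.sent m < a + x * δ → E.CarriesQC m u → ∀ p, E.HasQC p u a := by
    intro m u hm hu p
    obtain ⟨r, hr, hprod⟩ := h.exists_produces (hall _) hu
    have hrg : r ≤ E.gst := by
      by_contra! hlt
      exact hno u r hlt (by linarith) hprod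
    exact h.hasQC_of_produces (hall _) hprod (hall p) (by rw [max_eq_left hrg]; linarith)
  have hqc : ∀ i < k, ∃ m, E.CarriesQC m (k * j + i) ∧ E.sent m < a + x * δ := by
    intro i
    induction i with
    | zero =>
      intro _
      exact h.exists_qc_of_synchronised hx (initial_mul k j) le_rfl (by omega) (hall _)
        (by linarith) hS hclock fun hlt => absurd hlt (lt_irrefl _)
    | succ i ih =>
      intro hi
      obtain ⟨m, hm, hms⟩ := ih (by omega)
      exact h.exists_qc_of_synchronised hx (initial_mul k j) (by omega) (by omega) (hall _)
        (by linarith) hS hclock fun _ p _ => hknown m _ hms hm p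
  obtain ⟨m, hm, hms⟩ := hqc (k - 1) (by omega)
  have hn := three_mul_resilience_lt n
  obtain ⟨p, hp⟩ : S.Nonempty := Finset.card_pos.1 (by omega)
  obtain ⟨s, hs, hq⟩ := hknown m _ hms hm p
  have h1 := h.clockTime_le_clock_of_recvCert (hall p)
    (Or.inr ⟨_, rfl, hq⟩ : E.RecvCert p (k * j + (k - 1) + 1) s) hs
  rw [show k * j + (k - 1) + 1 = k * j + k by omega] at h1
  exact absurd ((hclock p hp).2 a le_rfl (by linarith)).2 (not_lt.2 h1)

/-- Let `j` be a block that `t + 1` processors have entered by GST while this fails for block `j +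
1`. Then no QC for block `j + 1` or later was produced by GST, so with no new QC either, clocks
there gain only real time. -/
theorem latency_le_of_byz_eq_empty (h : E.IsFeverExecution k x B Δ δ) (hx : 2 ≤ x) (hk : 3 ≤ k)
    (hall : ∀ p, E.Correct p) (hbegun : resilience n + 1 ≤ E.begunByGST) :
    E.latency k ≤ ((4 * (2 + x) * δ : ℝ) : EReal) := by
  classical
  have hΓ := h.gamma_pos hx
  have hg := h.network.gst_nonneg
  set T := E.gst + 4 * (2 + x) * δ with hT
  suffices hex : ∃ v r, E.gst < r ∧ r ≤ T ∧ E.Produces k v r by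
    obtain ⟨v, r, hr, hrT, hprod⟩ := hex
    refine (latency_le (firstQC_le hr (hall _) hprod)).trans ?_
    exact_mod_cast (by linarith : r - E.gst ≤ 4 * (2 + x) * δ)
  by_contra! hno
  have hzero : E.QuorumReaches (x * Δ) (k * 0) E.gst := by
    set S := (Set.toFinite {p | E.Correct p ∧ 0 ≤ E.clock p E.gst}).toFinset with hSdef
    by_cases hr : ∀ q ∈ S, E.Reaches (x * Δ) q (k * 0) E.gst
    · refine ⟨S, ?_, fun q hq => ⟨hall q, hr q hq⟩⟩
      rw [hSdef, ← Set.ncard_eq_toFinset_card]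
      exact hbegun
    push Not at hr
    obtain ⟨q, hqS, hq⟩ := hr
    rw [hSdef, Set.Finite.mem_toFinset] at hqS
    exact (h.reaches_or_quorumReaches hx (by omega) (initial_mul k 0) (hall q) hg
      (by rw [Nat.mul_zero, clockTime_zero]; exact hqS.2)).resolve_left hq
  obtain ⟨j, hj, hj'⟩ : ∃ j, E.QuorumReaches (x * Δ) (k * j) E.gst ∧
      ¬ E.QuorumReaches (x * Δ) (k * (j + 1)) E.gst := by
    by_contra! hsucc
    have hevery : ∀ j, E.QuorumReaches (x * Δ) (k * j) E.gst := fun j => by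
      induction j with
      | zero => exact hzero
      | succ j ih => exact hsucc j ih
    obtain ⟨b, hb⟩ := h.exists_clock_lt hx (by omega) E.gst
    obtain ⟨S, hS, hs⟩ := hevery b
    obtain ⟨q, hq⟩ : S.Nonempty := Finset.card_pos.1 (by omega)
    obtain ⟨hq1, s, h0, h1, h2⟩ := hs q hq
    have h3 := h.clock_mono hq1 h0 h1
    have h4 := hb q hq1
    linarith
  have hδ : 0 < (2 + x) * δ := mul_pos (by linarith) h.delta_pos
  have hiter : ∀ i : ℕ, i ≤ 4 →
      E.QuorumReaches (x * Δ) (k * (j + i)) (E.gst + i * ((2 + x) * δ)) := by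
    intro i
    induction i with
    | zero => intro _; simpa using hj
    | succ i ih =>
      intro hi
      have hi' : (i : ℝ) + 1 ≤ 4 := by exact_mod_cast hi
      have h1 := h.quorumReaches_succ hx (by omega) hall (T := T)
        (fun v r h1 h2 => hno v r h1 h2) (by nlinarith [Nat.cast_nonneg (α := ℝ) i])
        (by rw [hT]; nlinarith) (ih (by omega))
      have h2 : E.gst + (i : ℝ) * ((2 + x) * δ) + (2 + x) * δ =
        E.gst + ((i + 1 : ℕ) : ℝ) * ((2 + x) * δ) := by push_cast; ring
      rwa [h2] at h1
  obtain ⟨S, hS, hs⟩ := hiter 4 le_rfl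
  obtain ⟨q, hqS⟩ : S.Nonempty := Finset.card_pos.1 (by omega)
  obtain ⟨hq, s, hs0, hsT, hcs⟩ := hs q hqS
  push_cast at hsT
  have hv := initial_mul k (j + 1)
  obtain ⟨q₀, s₀, hq₀, h1, h2, h3, h4⟩ := h.exists_reaches_of_no_qc hx hv hq hs0
    (by rw [hcs, clockTime_le_clockTime hΓ]; exact Nat.mul_le_mul_left k (by omega))
    (fun m u hm hvu hu => by
      obtain ⟨r, hr, hprod⟩ := h.exists_produces (hall _) hu
      have hrg : r ≤ E.gst := by
        by_contra! hlt
        exact hno u r hlt (by rw [hT]; linarith) hprod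
      obtain ⟨m', -, h5, rfl⟩ := hprod.1
      exact hj' (h.quorumReaches_of_qc hx (by omega) hv hrg h5 hvu))
  have hk' : (3 : ℝ) ≤ k := by exact_mod_cast hk
  have hkΓ : 3 * (x * Δ) ≤ k * (x * Δ) := mul_le_mul_of_nonneg_right hk' hΓ.le
  have hxδ : x * δ ≤ x * Δ := mul_le_mul_of_nonneg_left h.delta_le (by linarith)
  have h2δ : 2 * δ ≤ x * δ := mul_le_mul_of_nonneg_right hx h.delta_pos.le
  -- The three blocks from `j + 1` to `j + 4` take 3kΓ ≥ 9Γ, but only 4(2 + x)δ ≤ 8Γ have passed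
  -- since GST. So the first of them was entered at least Γ before GST, contrary to the choice of
  -- `j`; four rounds are needed to gain this Γ when `k = 3`.
  have hlong : s₀ + x * Δ ≤ E.gst := by
    rw [hcs, clockTime, clockTime] at h4
    push_cast at h4
    linarith
  refine hj' (h.quorumReaches_of_clock hx (by omega) hv hq₀ hg ?_)
  have h5 := h.clock_add_le hq₀ h1 (τ := E.gst) (by linarith)
  rw [clockTime_add]
  push_cast
  linarith

end IsFeverExecution

end Execution

end Fever

theorem theorem1 (k : ℕ) (hk : 3 ≤ k) (x : ℝ) (hx : 2 ≤ x) (B : ℕ) :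
    ∃ C : ℕ, ∀ (n : ℕ) [NeZero n] (Δ δ : ℝ) (E : Fever.Execution n),
      E.IsFeverExecution k x B Δ δ →
        E.ViewMonotone ∧
        E.EventuallySynchronised k (x * Δ) ∧
        E.wordsFrom k (E.gst + 2 * δ) ≤ ((C * (E.byz.card * n + n) : ℕ) : ℕ∞) ∧
        (0 < E.begunByGST →
          (E.byz.card = 0 → Fever.resilience n + 1 ≤ E.begunByGST) →
          E.latency k ≤ ((C * (Δ * E.byz.card + δ) : ℝ) : EReal)) := by
  obtain ⟨X, hX⟩ := exists_nat_ge x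
  -- The summands serve the word count, the latency for `f > 0` (where `f + 2 ≤ 3f`) and the latency
  -- for `f = 0`.
  refine ⟨3 * (k * B + 2) + 3 * k * X + 4 * (2 + X), fun n _ Δ δ E h =>
    ⟨h.viewMonotone hx, h.eventuallySynchronised hx hk, (h.wordsFrom_le hx hk).trans ?_,
      fun h0 hbegun => ?_⟩⟩
  · exact_mod_cast Nat.mul_le_mul_right _ (by omega)
  have hδ := h.delta_pos
  have hΔ : 0 < Δ := hδ.trans_le h.delta_le
  rcases Nat.eq_zero_or_pos E.byz.card with hf | hf
  · refine (h.latency_le_of_byz_eq_empty hx hk (fun p => ?_) (hbegun hf)).trans ?_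
    · rw [Fever.Execution.Correct, Finset.card_eq_zero.1 hf]
      exact Finset.notMem_empty p
    · rw [hf]
      refine EReal.coe_le_coe_iff.2 ?_
      push_cast
      rw [mul_zero, zero_add]
      refine mul_le_mul_of_nonneg_right ?_ hδ.le
      have : (0 : ℝ) ≤ 3 * (k * B + 2) + 3 * k * X := by positivity
      linarith
  · obtain ⟨p, hp, hpc⟩ := Set.nonempty_of_ncard_ne_zero h0.ne'
    refine (h.latency_le_of_begun hx hk hp hpc).trans (EReal.coe_le_coe_iff.2 ?_)
    have hf' : (1 : ℝ) ≤ E.byz.card := by exact_mod_cast hf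
    push_cast
    calc x * Δ * (k * (E.byz.card + 2)) ≤ X * Δ * (k * (3 * E.byz.card)) := by
          gcongr
          linarith
      _ = 3 * k * X * (Δ * E.byz.card + 0) := by ring
      _ ≤ (3 * (k * B + 2) + 3 * k * X + 4 * (2 + X)) * (Δ * E.byz.card + δ) := by
          gcongr
          have h1 : (0 : ℝ) ≤ 3 * (k * B + 2) := by positivity
          have h2 : (0 : ℝ) ≤ 4 * (2 + X) := by positivity
          linarith
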